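/- Let $n$ be a positive integer, let $p,q,a,b,\rho_1,\rho_2,x_1,\dots,x_n$ be complex numbers with $|p|<1$ and $q,a,b,\rho_1,\rho_2,x_1,\dots,x_n\neq 0$. For $z\ne0$ put $\theta(z)=\theta(z;p)=\prod_{j\ge 0}(1-zp^j)(1-p^{j+1}/z)$, and for an integer $k$ let $(z)_k=(z;q,p)_k=\prod_{j=0}^{k-1}\theta(zq^j)$ if $k\ge0$ and $(z)_{k}=\prod_{j=1}^{-k}\theta(zq^{-j})^{-1}$ if $k<0$; write $(z_1,\dots,z_m)_k=(z_1)_k\cdots(z_m)_k$. For $n$-tuples $\boldsymbol k=(k_1,\dots,k_n)$ of non-negative integers put $|\boldsymbol k|=k_1+\dots+k_n$, and let $\boldsymbol j\le\boldsymbol k$ mean $j_r\le k_r$ for all $r$. All indices $r,s$ run over $1,\dots,n$. Define matrices indexed by such tuples by $$B^{(1)}_{\boldsymbol k\boldsymbol j}(a,b)=\frac{(b/a)_{|\boldsymbol k|-|\boldsymbol j|}}{\prod_{r,s}(q^{1+j_r-j_s}x_r/x_s)_{k_r-j_r}}\prod_{r}\frac{(bx_r)_{j_r+|\boldsymbol k|}}{(ax_rq)_{k_r+|\boldsymbol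 j|}},$$ $$B^{(4)}_{\boldsymbol k\boldsymbol j}(a,b)=\frac{\prod_{r,s}(bx_rx_s)_{k_r+j_s}}{\prod_{r<s}(bx_rx_s)_{j_r+j_s}\prod_{r,s}(q^{1+j_r-j_s}x_r/x_s)_{k_r-j_r}}\prod_{r}\frac{(bx_r/a)_{k_r-|\boldsymbol j|}}{(bx_r/a)_{j_r-|\boldsymbol j|}\,(ax_rq)_{k_r+|\boldsymbol j|}}.$$ Sequences $\alpha_{\boldsymbol N}(a,b),\beta_{\boldsymbol N}(a,b)$ form a WP Bailey pair with respect to $\mathbf B$ (at the parameters $(a,b)$) if $\beta_{\boldsymbol N}(a,b)=\sum_{\boldsymbol 0\le\boldsymbol j\le\boldsymbol N}B_{\boldsymbol N\boldsymbol j}(a,b)\,\alpha_{\boldsymbol j}(a,b)$ for all $\boldsymbol N$. Assume the parameters are such that no denominator vanishes, that is, for all $r,s$: $\theta(q^{m})\ne0$, $\theta(ax_rq^{m})\neq0$, $\theta(aq^{m}/\rho_1)\ne0$ and $\theta(aq^{m}/\rho_2)\neq0$ for integers $m\ge1$; $\theta(q^mx_r/x_s)\ne0$ for $r\neq s$ and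 all integers $m$; $\theta(b\rho_1x_rq^m/a)\neq0$, $\theta(b\rho_2x_rq^m/a)\neq0$ and $\theta(b\rho_1\rho_2x_rx_sq^m/aq)\ne0$ for $m\ge0$; and, if $n\ge2$, $\theta(b\rho_1\rho_2x_rq^{-m}/a^2q)\ne0$ for $m\ge1$. **Theorem (an elliptic $(\mathbf B^{(4)}\to\mathbf B^{(1)})$ WP Bailey lemma).** Suppose $\alpha,\beta$ form a WP Bailey pair with respect to $\mathbf B^{(4)}$ at the parameters $(a,b\rho_1\rho_2/aq)$. Let $$\alpha'_{\boldsymbol N}(a,b)=\frac{\prod_r(\rho_1x_r,\rho_2x_r)_{N_r}}{(aq/\rho_1,aq/\rho_2)_{|\boldsymbol N|}}\Big(\frac{aq}{\rho_1\rho_2}\Big)^{|\boldsymbol N|}\prod_rx_r^{-N_r}\cdot q^{\sum_{r<s}N_rN_s}\,\alpha_{\boldsymbol N}(a,b\rho_1\rho_2/aq),$$ $$\begin{aligned}\beta'_{\boldsymbol N}(a,b)={}&\frac{\prod_r(b\rho_1x_r/a,b\rho_2x_r/a)_{N_r}}{(aq/\rho_1,aq/\rho_2)_{|\boldsymbol N|}}\sum_{\boldsymbol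 0\le\boldsymbol k\le\boldsymbol N}\Bigg(\prod_r\frac{(\rho_1x_r,\rho_2x_r)_{k_r}\,(aq^{1+|\boldsymbol N|-N_r}/\rho_1\rho_2x_r)_{N_r-k_r}}{(b\rho_1x_r/a,b\rho_2x_r/a)_{k_r}}\\&\times\prod_{r<s}\frac{\theta(b\rho_1\rho_2x_rx_sq^{k_r+k_s}/aq)}{\theta(b\rho_1\rho_2x_rx_s/aq)}\prod_r\frac{\theta(b\rho_1\rho_2x_r^2q^{2k_r}/aq)}{\theta(b\rho_1\rho_2x_r^2/aq)}\\&\times\frac{\prod_{r<s}(b\rho_1\rho_2x_rx_s/a)_{N_r+N_s}\prod_r(bx_r)_{|\boldsymbol N|+k_r}}{\prod_{r,s}(b\rho_1\rho_2x_rx_s/a)_{N_s+k_r}\,(q^{1+k_r-k_s}x_r/x_s)_{N_r-k_r}}\\&\times\Big(\frac{aq}{\rho_1\rho_2}\Big)^{|\boldsymbol k|}\prod_rx_r^{-k_r}\cdot q^{\sum_{r<s}k_rk_s}\,\beta_{\boldsymbol k}(a,b\rho_1\rho_2/aq)\Bigg).\end{aligned}$$ Then $\alpha',\beta'$ form a WP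 Bailey pair with respect to $\mathbf B^{(1)}$ at the parameters $(a,b)$. -/

import Mathlib

namespace EllipticBailey

open Finset

/-- The infinite product `(a; p)_∞ = ∏_{j ≥ 0} (1 - a p^j)`, used for `|p| < 1`. -/
noncomputable def pochInf (a p : ℂ) : ℂ := ∏' j : ℕ, (1 - a * p ^ j)

/-- The modified Jacobi theta function `θ(a; p) = (a; p)_∞ (p/a; p)_∞`, for `a ≠ 0`, `|p| < 1`. -/
noncomputable def theta (p a : ℂ) : ℂ := pochInf a p * pochInf (p / a) p

/-- The theta shifted factorial `(a; q, p)_k` for an arbitrary integer `k`: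
`∏_{j=0}^{k-1} θ(a q^j; p)` for `k ≥ 0`, and
`(θ(a q^{-m}; p) ⋯ θ(a q^{-1}; p))⁻¹` for `k = -m < 0`. -/
noncomputable def thetaFac (p q a : ℂ) : ℤ → ℂ
  | Int.ofNat m => ∏ j ∈ range m, theta p (a * q ^ j)
  | Int.negSucc m => (∏ j ∈ range (m + 1), theta p (a / q ^ (j + 1)))⁻¹

variable {n : ℕ}

/-- `|k| = k_1 + ⋯ + k_n`. -/
def size (k : Fin n → ℕ) : ℕ := ∑ r, k r

/-- `∑_{r<s} k_r k_s`. -/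
def pairSum (k : Fin n → ℕ) : ℕ := ∑ r, ∑ s ∈ Ioi r, k r * k s

/-- `∏_{r<s} F r s`, the product over `1 ≤ r < s ≤ n`. -/
noncomputable def prodLT (F : Fin n → Fin n → ℂ) : ℂ := ∏ r, ∏ s ∈ Ioi r, F r s

/-- Sequences indexed by `n`-tuples of non-negative integers that depend on two parameters
`a`, `b`; `α k a b` stands for `α_k(a, b)`. -/
abbrev Seq (n : ℕ) : Type := (Fin n → ℕ) → ℂ → ℂ → ℂ

/-- Matrices with rows and columns indexed by `n`-tuples of non-negative integers that depend on
two parameters `a`, `b`; `B k j a b` stands for `B_{kj}(a, b)`. -/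
abbrev Mat (n : ℕ) : Type := (Fin n → ℕ) → (Fin n → ℕ) → ℂ → ℂ → ℂ

/-- `α` and `β` form a WP Bailey pair with respect to `B`, at the parameters `a`, `b`:
`β_N(a,b) = ∑_{0 ≤ j_r ≤ N_r} B_{Nj}(a,b) α_j(a,b)` for all `N`. -/
def IsWPBaileyPair (B : Mat n) (α β : Seq n) (a b : ℂ) : Prop :=
  ∀ N : Fin n → ℕ, β N a b = ∑ j ∈ Iic N, B N j a b * α j a b

/-- The `A_n` elliptic Bressoud matrix `B⁽¹⁾`. -/
noncomputable def B1 (p q : ℂ) (x : Fin n → ℂ) : Mat n := fun k j a b =>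
  thetaFac p q (b / a) ((size k : ℤ) - size j)
    / (∏ r, ∏ s, thetaFac p q (q ^ (1 + (j r : ℤ) - j s) * (x r / x s)) ((k r : ℤ) - j r))
  * ∏ r, (thetaFac p q (b * x r) (j r + size k) / thetaFac p q (a * x r * q) (k r + size j))

/-- The `D_n` elliptic Bressoud matrix `B⁽⁴⁾`. -/
noncomputable def B4 (p q : ℂ) (x : Fin n → ℂ) : Mat n := fun k j a b =>
  (∏ r, ∏ s, thetaFac p q (b * x r * x s) (k r + j s))
    / (prodLT (fun r s => thetaFac p q (b * x r * x s) (j r + j s))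
      * ∏ r, ∏ s, thetaFac p q (q ^ (1 + (j r : ℤ) - j s) * (x r / x s)) ((k r : ℤ) - j r))
  * ∏ r, (thetaFac p q (b * x r / a) ((k r : ℤ) - size j)
      / (thetaFac p q (b * x r / a) ((j r : ℤ) - size j)
        * thetaFac p q (a * x r * q) (k r + size j)))

/-- The sequence `α'_N(a, b)` built from `α`. -/
noncomputable def alphaPrime (p q ρ₁ ρ₂ : ℂ) (x : Fin n → ℂ) (α : Seq n) : Seq n := fun N a b =>
  (∏ r, (thetaFac p q (ρ₁ * x r) (N r) * thetaFac p q (ρ₂ * x r) (N r)))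
    / (thetaFac p q (a * q / ρ₁) (size N) * thetaFac p q (a * q / ρ₂) (size N))
  * (a * q / (ρ₁ * ρ₂)) ^ size N
  * (∏ r, (x r ^ N r)⁻¹)
  * q ^ pairSum N
  * α N a (b * ρ₁ * ρ₂ / (a * q))

/-- The sequence `β'_N(a, b)` built from `β`. -/
noncomputable def betaPrime (p q ρ₁ ρ₂ : ℂ) (x : Fin n → ℂ) (β : Seq n) : Seq n := fun N a b =>
  (∏ r, (thetaFac p q (b * ρ₁ * x r / a) (N r) * thetaFac p q (b * ρ₂ * x r / a) (N r)))
    / (thetaFac p q (a * q / ρ₁) (size N) * thetaFac p q (a * q / ρ₂) (size N))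
  * ∑ k ∈ Iic N,
    ((∏ r, (thetaFac p q (ρ₁ * x r) (k r) * thetaFac p q (ρ₂ * x r) (k r)
          * thetaFac p q (a * q ^ (1 + (size N : ℤ) - N r) / (ρ₁ * ρ₂ * x r)) ((N r : ℤ) - k r)
        / (thetaFac p q (b * ρ₁ * x r / a) (k r) * thetaFac p q (b * ρ₂ * x r / a) (k r))))
    * prodLT (fun r s =>
        theta p (b * ρ₁ * ρ₂ * x r * x s * q ^ (k r + k s) / (a * q))
          / theta p (b * ρ₁ * ρ₂ * x r * x s / (a * q)))
    * (∏ r, (theta p (b * ρ₁ * ρ₂ * x r ^ 2 * q ^ (2 * k r) / (a * q))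
          / theta p (b * ρ₁ * ρ₂ * x r ^ 2 / (a * q))))
    * (prodLT (fun r s => thetaFac p q (b * ρ₁ * ρ₂ * x r * x s / a) (N r + N s))
        * (∏ r, thetaFac p q (b * x r) (size N + k r))
      / ∏ r, ∏ s, (thetaFac p q (b * ρ₁ * ρ₂ * x r * x s / a) (N s + k r)
          * thetaFac p q (q ^ (1 + (k r : ℤ) - k s) * (x r / x s)) ((N r : ℤ) - k r)))
    * (a * q / (ρ₁ * ρ₂)) ^ size k
    * (∏ r, (x r ^ k r)⁻¹)
    * q ^ pairSum k
    * β k a (b * ρ₁ * ρ₂ / (a * q)))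

end EllipticBailey

namespace EllipticBailey

open Finset

/-! ### The modified theta function -/

/-! Inserting β as a sum over α into β' and interchanging the sums reduces the theorem to a product
of matrices: for fixed j ≤ N, the sum over j ≤ k ≤ N of the coefficient of β_k in β'_N times
B⁽⁴⁾_{kj} is, up to the prefactor of β', the entry B⁽¹⁾_{Nj} times the factor in α'_j
(`sum_betaWeight_mul_B4`). This is an elliptic Jackson summation of type C_n.

That summation is a specialization of a sum over all subsets S of a finite set T with free variables
y_u (`sum_subsetTerm`). Let T be the strip of points (r, i) with j_r ≤ i < N_r, and let y_(r,i) =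
x_r q^i. The factors θ(y_u/(q y_v)) with u ∈ S, v ∉ S kill every S that is not an initial segment in
each row. The surviving S are the strips from j to k, and on them all products collapse to theta
shifted factorials.

The subset sum is evaluated by induction on #T. With c, d and K = be fixed, θ(bz) θ(Kz/b) has rank
two in b and z (`theta_pair_rank_two`). Hence both sides are forms of degree #T in two functions of
b, and it is enough to compare them at #T + 1 points where these two functions have different ratios
(`eq_zero_of_mem_forms`). At b = 1/y_w all terms with w ∈ S vanish, at b = A y_w all terms with w ∉
S; in both cases the rest is the sum for T \ {w} with b/q in place of b. The points 1/y_u and a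
single A y_w suffice. They are in general position except for countably many d, and these values are
reached by continuity. -/

lemma summable_norm_mul_pow {p : ℂ} (hp : ‖p‖ < 1) (z : ℂ) :
    Summable fun j : ℕ => ‖-(z * p ^ j)‖ := by
  simpa [norm_mul, norm_pow] using
    (summable_geometric_of_lt_one (norm_nonneg p) hp).mul_left ‖z‖

lemma pochInf_eq {p : ℂ} (z : ℂ) : pochInf z p = ∏' j : ℕ, (1 + -(z * p ^ j)) := by
  simp [pochInf, sub_eq_add_neg]

lemma pochInf_succ {p : ℂ} (hp : ‖p‖ < 1) (z : ℂ) :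
    pochInf z p = (1 - z) * pochInf (z * p) p := by
  have h : Multipliable fun j : ℕ => (1 + -(z * p * p ^ j)) :=
    multipliable_one_add_of_summable (summable_norm_mul_pow hp (z * p))
  rw [pochInf_eq, pochInf_eq, tprod_eq_zero_mul']
  · simp only [pow_zero, mul_one, pow_succ, sub_eq_add_neg]
    congr 2
    ext j
    ring
  · convert h using 4
    ring

lemma pochInf_zero {p : ℂ} : pochInf 0 p = 1 := by simp [pochInf]

/-- A geometric majorant on a ball makes the partial products, which are polynomials in z, converge
locally uniformly. -/
lemma differentiable_pochInf {p : ℂ} (hp : ‖p‖ < 1) : Differentiable ℂ fun z => pochInf z p := by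
  intro z
  have hU : IsOpen (Metric.ball (0 : ℂ) (‖z‖ + 1)) := Metric.isOpen_ball
  have h := Summable.hasProdLocallyUniformlyOn_nat_one_add (f := fun (j : ℕ) (z : ℂ) => -(z * p ^ j))
    hU (u := fun j => (‖z‖ + 1) * ‖p‖ ^ j)
    ((summable_geometric_of_lt_one (norm_nonneg p) hp).mul_left _)
    (Filter.Eventually.of_forall fun j w hw => by
      rw [norm_neg, norm_mul, norm_pow]
      have : ‖w‖ < ‖z‖ + 1 := by simpa using hw
      gcongr) (fun j => by fun_prop)
  have h2 := (hasProdLocallyUniformlyOn_iff_tendstoLocallyUniformlyOn.mp h).differentiableOn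
    (Filter.Eventually.of_forall fun s => by
      apply Differentiable.differentiableOn
      fun_prop) hU
  have h3 := h2.differentiableAt (hU.mem_nhds (x := z) (by simp))
  simpa only [← pochInf_eq] using h3

lemma theta_one {p : ℂ} (hp : ‖p‖ < 1) : theta p 1 = 0 := by
  rw [theta, pochInf_succ hp]
  simp

lemma theta_inv {p : ℂ} (hp : ‖p‖ < 1) {z : ℂ} (hz : z ≠ 0) :
    theta p z⁻¹ = -z⁻¹ * theta p z := by
  rw [theta, theta, pochInf_succ hp z⁻¹, pochInf_succ hp z]
  rw [show p / z⁻¹ = z * p by field_simp, show z⁻¹ * p = p / z by field_simp]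
  field_simp
  ring

lemma theta_eq_neg_mul {p : ℂ} (hp : ‖p‖ < 1) {z w : ℂ} (hz : z ≠ 0) (h : z * w = 1) :
    theta p z = -z * theta p w := by
  rw [eq_inv_of_mul_eq_one_right h, theta_inv hp hz]
  field_simp

lemma theta_mul_nome {p : ℂ} (hp : ‖p‖ < 1) (hp0 : p ≠ 0) {z : ℂ} (hz : z ≠ 0) :
    z * theta p (p * z) = -theta p z := by
  rw [theta, theta, pochInf_succ hp z, show p / (p * z) = z⁻¹ by field_simp,
    pochInf_succ hp z⁻¹, show z⁻¹ * p = p / z by field_simp, mul_comm z p]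
  field_simp
  ring

lemma continuousAt_theta {p : ℂ} (hp : ‖p‖ < 1) {z : ℂ} (hz : z ≠ 0) :
    ContinuousAt (theta p) z := by
  have h := (differentiable_pochInf hp).continuous
  unfold theta
  exact h.continuousAt.mul
    (ContinuousAt.comp' (g := fun z => pochInf z p) h.continuousAt (continuousAt_const.div continuousAt_id hz))

lemma pochInf_eq_zero {p : ℂ} (hp : ‖p‖ < 1) {z : ℂ} (h : pochInf z p = 0) :
    ∃ j : ℕ, z * p ^ j = 1 := by
  by_contra! hne
  rw [pochInf_eq] at h
  exact tprod_one_add_ne_zero_of_summable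
    (fun j hj => hne j (by linear_combination -hj)) (summable_norm_mul_pow hp z) h

/-- Needed only to see that the zeros form a countable set. -/
lemma theta_eq_zero {p : ℂ} (hp : ‖p‖ < 1) {z : ℂ} (hz : z ≠ 0) (h : theta p z = 0) :
    ∃ m : ℤ, z = p ^ m := by
  rcases mul_eq_zero.mp h with h | h
  · obtain ⟨j, hj⟩ := pochInf_eq_zero hp h
    exact ⟨-j, by rw [zpow_neg, zpow_natCast]; exact eq_inv_of_mul_eq_one_left hj⟩
  · obtain ⟨j, hj⟩ := pochInf_eq_zero hp h
    refine ⟨(j + 1 : ℕ), ?_⟩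
    rw [zpow_natCast, pow_succ]
    field_simp at hj
    rw [← hj]
    ring

/-! ### Laurent series -/

lemma hasSum_mul_prod {ι : Type*} {f g : ι → ℂ} {a b : ℂ} (hf : HasSum f a) (hg : HasSum g b) :
    HasSum (fun t : ι × ι => f t.1 * g t.2) (a * b) :=
  HasSum.mul hf hg (summable_mul_of_summable_norm hf.summable.norm hg.summable.norm)

/-- `f` is the sum of a Laurent series with coefficients `c`, convergent on `ℂ \ {0}`. -/
def HasLaurent (f : ℂ → ℂ) (c : ℤ → ℂ) : Prop :=
  ∀ z : ℂ, z ≠ 0 → HasSum (fun k : ℤ => c k * z ^ k) (f z)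

/-- The double series converges absolutely and may be summed along the fibres of addition. -/
lemma HasLaurent.mul {f g : ℂ → ℂ} {c d : ℤ → ℂ} (hf : HasLaurent f c) (hg : HasLaurent g d) :
    ∃ e, HasLaurent (fun z => f z * g z) e := by
  obtain ⟨S, hS⟩ : ∃ S : ℤ → Set (ℤ × ℤ), S = fun k => (fun t : ℤ × ℤ => t.1 + t.2) ⁻¹' {k} :=
    ⟨_, rfl⟩
  have hsum : ∀ (F : ℤ × ℤ → ℂ) (s : ℂ), HasSum F s → HasSum (fun k : ℤ => ∑' b : S k, F b) s := by
    subst hS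
    exact fun F s h => h.tsum_fiberwise _
  have hmem : ∀ (k : ℤ) (b : S k), b.1.1 + b.1.2 = k := by
    subst hS
    exact fun k b => b.2
  refine ⟨fun k => ∑' b : S k, c b.1.1 * d b.1.2, fun z hz => ?_⟩
  have h1 := hasSum_mul_prod (hf z hz) (hg z hz)
  refine HasSum.congr_fun (hsum _ _ h1) fun k => ?_
  rw [← tsum_mul_right]
  refine tsum_congr fun b => ?_
  have hk : z ^ k = z ^ b.1.1 * z ^ b.1.2 := by
    rw [← zpow_add₀ hz, hmem k b]
  rw [hk]
  ring

lemma HasLaurent.comp_mul {f : ℂ → ℂ} {c : ℤ → ℂ} (hf : HasLaurent f c) {w : ℂ} (hw : w ≠ 0) :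
    HasLaurent (fun z => f (w * z)) (fun k => c k * w ^ k) := by
  intro z hz
  simpa only [mul_zpow, mul_assoc] using hf (w * z) (mul_ne_zero hw hz)

lemma HasLaurent.comp_inv {f : ℂ → ℂ} {c : ℤ → ℂ} (hf : HasLaurent f c) :
    HasLaurent (fun z => f z⁻¹) (fun k => c (-k)) := by
  intro z hz
  have := (Equiv.neg ℤ).hasSum_iff.mpr (hf z⁻¹ (inv_ne_zero hz))
  simpa [Function.comp_def] using this

lemma hasLaurent_of_entire {f : ℂ → ℂ} (hf : Differentiable ℂ f) : ∃ c, HasLaurent f c := by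
  refine ⟨fun k => if 0 ≤ k then ((k.toNat.factorial : ℂ))⁻¹ * iteratedDeriv k.toNat f 0 else 0,
    fun z hz => ?_⟩
  have h := Complex.hasSum_taylorSeries_of_entire hf 0 z
  have hinj : Function.Injective (Nat.cast : ℕ → ℤ) := Nat.cast_injective
  rw [← hinj.hasSum_iff]
  · have e : (fun k : ℤ => (if 0 ≤ k then ((k.toNat.factorial : ℂ))⁻¹ * iteratedDeriv k.toNat f 0
        else 0) * z ^ k) ∘ (Nat.cast : ℕ → ℤ) =
        fun n : ℕ => (n.factorial : ℂ)⁻¹ • (z - 0) ^ n • iteratedDeriv n f 0 := by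
      funext k
      simp only [Function.comp_apply, Int.natCast_nonneg, if_true, Int.toNat_natCast, zpow_natCast,
        sub_zero, smul_eq_mul]
      ring
    rw [e]
    exact h
  · intro k hk
    have : ¬ 0 ≤ k := fun h0 => hk ⟨k.toNat, by simp [h0]⟩
    simp [this]

/-- On the unit circle this is an absolutely convergent Fourier series with sum zero; the L² inner
product with the k-th exponential isolates `c k`. -/
lemma HasLaurent.coeff_eq_zero {c : ℤ → ℂ} (h : HasLaurent (fun _ => 0) c) (k : ℤ) : c k = 0 := by
  have : Fact ((0 : ℝ) < 1) := ⟨one_pos⟩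
  have hs : Summable fun k : ℤ => ‖c k‖ := by
    simpa using (h 1 one_ne_zero).summable.norm
  have hs' : Summable fun k : ℤ => c k • (fourier k : C(AddCircle (1 : ℝ), ℂ)) := by
    refine Summable.of_norm ?_
    simpa [norm_smul, fourier_norm] using hs
  obtain ⟨F, hF⟩ := hs'
  have hF0 : F = 0 := by
    ext t
    have h1 := hF.map (ContinuousMap.evalCLM ℂ t) (ContinuousMap.evalCLM ℂ t).continuous
    have h2 := h (AddCircle.toCircle t) (by simp)
    refine HasSum.unique h1 (a₂ := 0) ?_
    convert h2 using 2 with k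
    simp [fourier_apply, AddCircle.toCircle_zsmul]
  rw [hF0] at hF
  have hL := hF.map (ContinuousMap.toLp (E := ℂ) 2 AddCircle.haarAddCircle ℂ)
    (ContinuousMap.toLp (E := ℂ) 2 AddCircle.haarAddCircle ℂ).continuous
  have hI := hL.map (innerSL ℂ (fourierLp (T := 1) 2 k)) (innerSL ℂ (fourierLp (T := 1) 2 k)).continuous
  have horth := orthonormal_iff_ite.mp (orthonormal_fourier (T := 1)) k
  have h3 : HasSum (fun m : ℤ => if m = k then c k else 0) (0 : ℂ) := by
    convert hI using 2 with m
    · have := horth m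
      simp only [Function.comp_apply, map_smul, innerSL_apply_apply, smul_eq_mul]
      change _ = c m * inner ℂ (fourierLp 2 k) (fourierLp 2 m)
      rw [this]
      by_cases hm : m = k
      · simp [hm]
      · simp [hm, Ne.symm hm]
    · simp
  exact (hasSum_ite_eq k (c k)).unique h3

lemma exists_hasLaurent_theta {p : ℂ} (hp : ‖p‖ < 1) (hp0 : p ≠ 0) :
    ∃ c, HasLaurent (theta p) c := by
  obtain ⟨c, hc⟩ := hasLaurent_of_entire (differentiable_pochInf hp)
  have h2 := (hc.comp_mul hp0).comp_inv
  obtain ⟨e, he⟩ := hc.mul h2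
  exact ⟨e, he⟩

/-- Comparison of the coefficients of z^(s+2). The recurrence leaves only `c 0` and `c 1` free,
which is the source of the rank two below. -/
lemma hasLaurent_quasiperiodic {p : ℂ} (hp0 : p ≠ 0) {f : ℂ → ℂ} {c : ℤ → ℂ}
    (hc : HasLaurent f c) (hf : ∀ z, z ≠ 0 → z ^ 2 * f (p * z) = f z) (s : ℤ) :
    c (s + 2) = p ^ s * c s := by
  have h : HasLaurent (fun _ => 0) (fun k => c (k - 2) * p ^ (k - 2) - c k) := by
    intro z hz
    have h1 : HasSum (fun k : ℤ => z ^ 2 * (c k * p ^ k * z ^ k)) (f z) := by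
      rw [← hf z hz]
      exact ((hc.comp_mul hp0) z hz).mul_left (z ^ 2)
    have h2 := ((Equiv.subRight (2 : ℤ)).hasSum_iff.mpr h1).sub (hc z hz)
    rw [sub_self] at h2
    refine HasSum.congr_fun h2 fun k => ?_
    change _ = z ^ 2 * (c (k - 2) * p ^ (k - 2) * z ^ (k - 2)) - c k * z ^ k
    rw [show z ^ k = z ^ 2 * z ^ (k - 2) by
      rw [← zpow_natCast z 2, ← zpow_add₀ hz]; congr 1; push_cast; ring]
    ring
  have := h.coeff_eq_zero (s + 2)
  simp only [add_sub_cancel_right] at this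
  linear_combination -this

lemma coeff_of_quasiperiodic {p : ℂ} (hp0 : p ≠ 0) {c : ℤ → ℂ}
    (h : ∀ s, c (s + 2) = p ^ s * c s) (u : ℤ) :
    c (2 * u) = p ^ (u * (u - 1)) * c 0 ∧ c (2 * u + 1) = p ^ (u * u) * c 1 := by
  induction u using Int.induction_on with
  | zero => simp
  | succ u ih =>
    obtain ⟨h1, h2⟩ := ih
    constructor
    · rw [show 2 * ((u : ℤ) + 1) = 2 * u + 2 by ring, h, h1, ← mul_assoc, ← zpow_add₀ hp0]
      congr 2
      ring
    · rw [show 2 * ((u : ℤ) + 1) + 1 = (2 * u + 1) + 2 by ring, h, h2, ← mul_assoc, ← zpow_add₀ hp0]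
      congr 2
      ring
  | pred u ih =>
    obtain ⟨h1, h2⟩ := ih
    have e1 := h (2 * (-(u : ℤ) - 1))
    have e2 := h (2 * (-(u : ℤ) - 1) + 1)
    rw [show 2 * (-(u : ℤ) - 1) + 2 = 2 * -(u : ℤ) by ring, h1] at e1
    rw [show 2 * (-(u : ℤ) - 1) + 1 + 2 = 2 * -(u : ℤ) + 1 by ring, h2] at e2
    constructor
    · apply mul_left_cancel₀ (zpow_ne_zero (2 * (-(u : ℤ) - 1)) hp0)
      rw [← e1, ← mul_assoc, ← zpow_add₀ hp0]
      congr 2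
      ring
    · apply mul_left_cancel₀ (zpow_ne_zero (2 * (-(u : ℤ) - 1) + 1) hp0)
      rw [← e2, ← mul_assoc, ← zpow_add₀ hp0]
      congr 2
      ring

lemma hasSum_int_even_add_odd {f : ℤ → ℂ} (hf : Summable f) :
    HasSum f ((∑' u : ℤ, f (2 * u)) + ∑' u : ℤ, f (2 * u + 1)) := by
  have i1 : Function.Injective fun u : ℤ => 2 * u := fun a b h => by simpa using h
  have i2 : Function.Injective fun u : ℤ => 2 * u + 1 := fun a b h => by simpa using h
  have h1 : (Set.range fun u : ℤ => 2 * u) = {k | Even k} := by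
    ext k
    exact ⟨fun ⟨u, hu⟩ => ⟨u, by rw [← hu]; ring⟩, fun ⟨u, hu⟩ => ⟨u, by rw [hu]; ring⟩⟩
  have h2 : (Set.range fun u : ℤ => 2 * u + 1) = {k | Odd k} := by
    ext k
    exact ⟨fun ⟨u, hu⟩ => ⟨u, hu.symm⟩, fun ⟨u, hu⟩ => ⟨u, hu.symm⟩⟩
  refine HasSum.add_isCompl (s := {k | Even k}) (t := {k | Odd k}) Int.isCompl_even_odd ?_ ?_
  · rw [← h1]
    exact i1.hasSum_range_iff.mpr (hf.comp_injective i1).hasSum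
  · rw [← h2]
    exact i2.hasSum_range_iff.mpr (hf.comp_injective i2).hasSum

/-- `θ(xy) θ(x/y)` has rank two as a function of `x` and `y`. -/
lemma theta_mul_theta_rank_two {p : ℂ} (hp : ‖p‖ < 1) :
    ∃ G₀ G₁ H₀ H₁ : ℂ → ℂ, ∀ x y, x ≠ 0 → y ≠ 0 →
      theta p (x * y) * theta p (x / y) = G₀ x * H₀ y + G₁ x * H₁ y := by
  -- For p = 0 one has θ(z) = 1 - z, and the product is (1 + x²) - x (y + 1/y).
  by_cases hp0 : p = 0
  · have h0 : ∀ z : ℂ, theta 0 z = 1 - z := by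
      intro z
      rw [theta, zero_div, pochInf_zero, pochInf_succ (by simp), mul_zero, pochInf_zero]
      ring
    subst hp0
    refine ⟨fun x => 1 + x ^ 2, fun x => -x, fun _ => 1, fun y => y + y⁻¹, fun x y hx hy => ?_⟩
    rw [h0, h0]
    field_simp
    ring
  obtain ⟨c, hc⟩ := exists_hasLaurent_theta hp hp0
  have hC : ∀ y : ℂ, ∃ C, y ≠ 0 → HasLaurent (fun x => theta p (y * x) * theta p (y⁻¹ * x)) C := by
    intro y
    by_cases hy : y = 0
    · exact ⟨0, fun h => absurd hy h⟩
    · obtain ⟨C, hC⟩ := (hc.comp_mul hy).mul (hc.comp_mul (inv_ne_zero hy))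
      exact ⟨C, fun _ => hC⟩
  choose C hC using hC
  -- The product is divided by x² under x ↦ px. So its Laurent coefficients in x of even index are
  -- fixed multiples of the one of index 0, those of odd index of the one of index 1, and only these
  -- two depend on y.
  refine ⟨fun x => ∑' u : ℤ, p ^ (u * (u - 1)) * x ^ (2 * u),
    fun x => ∑' u : ℤ, p ^ (u * u) * x ^ (2 * u + 1), fun y => C y 0, fun y => C y 1,
    fun x y hx hy => ?_⟩
  have hq := hasLaurent_quasiperiodic hp0 (hC y hy) (fun z hz => by
    have h1 := theta_mul_nome hp hp0 (mul_ne_zero hy hz)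
    have h2 := theta_mul_nome hp hp0 (mul_ne_zero (inv_ne_zero hy) hz)
    have h3 : z ^ 2 = (y * z) * (y⁻¹ * z) := by field_simp
    rw [mul_left_comm y p z, mul_left_comm y⁻¹ p z, h3]
    linear_combination (y * z * theta p (p * (y * z))) * h2 - theta p (y⁻¹ * z) * h1)
  have hco := coeff_of_quasiperiodic hp0 hq
  have hsum : HasSum (fun k : ℤ => C y k * x ^ k) (theta p (y * x) * theta p (y⁻¹ * x)) :=
    hC y hy x hx
  have hfin := hsum.unique (hasSum_int_even_add_odd hsum.summable)
  rw [mul_comm x y, div_eq_mul_inv, mul_comm x y⁻¹, hfin, ← tsum_mul_right, ← tsum_mul_right]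
  congr 1
  · refine tsum_congr fun u => ?_
    rw [(hco u).1]
    ring
  · refine tsum_congr fun u => ?_
    rw [(hco u).2]
    ring

/-- For fixed `K`, the function `θ(bz) θ(Kz/b)` has rank two as a function of `b` and `z`. -/
lemma theta_pair_rank_two {p : ℂ} (hp : ‖p‖ < 1) {K : ℂ} (hK : K ≠ 0) :
    ∃ G₀ G₁ H₀ H₁ : ℂ → ℂ, ∀ b z, b ≠ 0 → z ≠ 0 →
      theta p (b * z) * theta p (K * z / b) = G₀ b * H₀ z + G₁ b * H₁ z := by
  -- With κ² = K, the arguments bz and Kz/b are the product and the quotient of κz and b/κ.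
  obtain ⟨κ, hκ⟩ := IsAlgClosed.exists_pow_nat_eq K (n := 2) two_pos
  have hκ0 : κ ≠ 0 := by
    rintro rfl
    exact hK (by simp [← hκ])
  obtain ⟨G₀, G₁, H₀, H₁, h⟩ := theta_mul_theta_rank_two hp
  refine ⟨fun b => H₀ (b / κ), fun b => H₁ (b / κ), fun z => G₀ (κ * z), fun z => G₁ (κ * z),
    fun b z hb hz => ?_⟩
  have := h (κ * z) (b / κ) (mul_ne_zero hκ0 hz) (div_ne_zero hb hκ0)
  rw [show κ * z * (b / κ) = b * z by field_simp,
    show κ * z / (b / κ) = K * z / b by rw [← hκ]; field_simp] at this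
  rw [this]
  ring

/-! ### Homogeneous forms in two functions -/

/-- Functions on `ℂ \ {0}` that are homogeneous polynomials of degree `m` in `G₀` and `G₁`. -/
def forms (G₀ G₁ : ℂ → ℂ) (m : ℕ) : Submodule ℂ (ℂˣ → ℂ) :=
  Submodule.span ℂ (Set.range fun (i : Fin (m + 1)) (b : ℂˣ) => G₀ b ^ (i : ℕ) * G₁ b ^ (m - i : ℕ))

lemma const_mem_forms {G₀ G₁ : ℂ → ℂ} (c : ℂ) : (fun _ => c) ∈ forms G₀ G₁ 0 := by
  have : (fun _ => c) = c • (fun (b : ℂˣ) => G₀ b ^ ((0 : Fin 1) : ℕ) * G₁ b ^ (0 - (0 : Fin 1) : ℕ)) := by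
    funext b
    simp
  rw [this]
  exact Submodule.smul_mem _ _ (Submodule.subset_span ⟨0, rfl⟩)

lemma mul_mem_forms {G₀ G₁ : ℂ → ℂ} {m : ℕ} {F : ℂˣ → ℂ} (hF : F ∈ forms G₀ G₁ m) (h₀ h₁ : ℂ) :
    (fun b : ℂˣ => F b * (G₀ b * h₀ + G₁ b * h₁)) ∈ forms G₀ G₁ (m + 1) := by
  induction hF using Submodule.span_induction with
  | mem F hF =>
    obtain ⟨i, rfl⟩ := hF
    have e : (fun b : ℂˣ => G₀ b ^ (i : ℕ) * G₁ b ^ (m - i : ℕ) * (G₀ b * h₀ + G₁ b * h₁)) =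
        h₀ • (fun b : ℂˣ => G₀ b ^ ((i.succ : Fin (m + 2)) : ℕ) *
          G₁ b ^ (m + 1 - (i.succ : Fin (m + 2)) : ℕ)) +
        h₁ • (fun b : ℂˣ => G₀ b ^ ((i.castSucc : Fin (m + 2)) : ℕ) *
          G₁ b ^ (m + 1 - (i.castSucc : Fin (m + 2)) : ℕ)) := by
      funext b
      have hi : m + 1 - (i : ℕ) = (m - i) + 1 := by omega
      simp only [Pi.add_apply, Pi.smul_apply, smul_eq_mul, Fin.val_succ, Fin.val_castSucc,
        Nat.add_sub_add_right, hi, pow_succ]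
      ring
    rw [e]
    exact Submodule.add_mem _ (Submodule.smul_mem _ _ (Submodule.subset_span ⟨i.succ, rfl⟩))
      (Submodule.smul_mem _ _ (Submodule.subset_span ⟨i.castSucc, rfl⟩))
  | zero =>
    convert Submodule.zero_mem (forms G₀ G₁ (m + 1)) using 1
    funext b
    simp
  | add F F' _ _ h h' =>
    convert Submodule.add_mem _ h h' using 1
    funext b
    simp only [Pi.add_apply]
    ring
  | smul a F _ h =>
    convert Submodule.smul_mem _ a h using 1
    funext b
    simp only [Pi.smul_apply, smul_eq_mul]
    ring

lemma mul_prod_mem_forms {G₀ G₁ : ℂ → ℂ} {ι : Type*} {φ : ℂ → ι → ℂ} {H₀ H₁ : ι → ℂ}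
    (hφ : ∀ (b : ℂˣ) u, φ b u = G₀ b * H₀ u + G₁ b * H₁ u) {m k : ℕ} {F : ℂˣ → ℂ}
    (hF : F ∈ forms G₀ G₁ m) (S : Finset ι) (hk : m + #S = k) :
    (fun b : ℂˣ => F b * ∏ u ∈ S, φ b u) ∈ forms G₀ G₁ k := by
  classical
  subst hk
  induction S using Finset.induction_on with
  | empty => simpa using hF
  | insert w S hw ih =>
    rw [card_insert_of_notMem hw, ← add_assoc]
    convert mul_mem_forms ih (H₀ w) (H₁ w) using 1
    funext b
    rw [prod_insert hw, hφ]
    ring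

/-- The monomials of degree m at the m + 1 points form a projective Vandermonde matrix. Its
determinant is a product of the 2 × 2 determinants that `hβ` makes nonzero, so all coefficients of
the form vanish. -/
lemma eq_zero_of_mem_forms {G₀ G₁ : ℂ → ℂ} {m : ℕ} {F : ℂˣ → ℂ} (hF : F ∈ forms G₀ G₁ m)
    {κ : Type*} [Fintype κ] (hκ : Fintype.card κ = m + 1) (β : κ → ℂˣ)
    (hβ : ∀ i j, i ≠ j → G₀ (β i) * G₁ (β j) ≠ G₁ (β i) * G₀ (β j))
    (h0 : ∀ i, F (β i) = 0) (b : ℂˣ) : F b = 0 := by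
  obtain ⟨c, rfl⟩ := (Submodule.mem_span_range_iff_exists_fun ℂ).mp hF
  let e := Fintype.equivFinOfCardEq hκ
  have hdet : (Matrix.projVandermonde (fun i => G₀ (β (e.symm i)))
      (fun i => G₁ (β (e.symm i)))).det ≠ 0 := by
    rw [Matrix.det_projVandermonde]
    refine prod_ne_zero_iff.mpr fun i _ => prod_ne_zero_iff.mpr fun j hj => sub_ne_zero.mpr ?_
    have hij : i ≠ j := (mem_Ioi.mp hj).ne
    intro h
    refine hβ (e.symm i) (e.symm j) (fun h => hij (e.symm.injective h)) ?_
    linear_combination -h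
  have hc : c = 0 := by
    refine Matrix.eq_zero_of_mulVec_eq_zero hdet ?_
    funext i
    have := h0 (e.symm i)
    simp only [Finset.sum_apply, Pi.smul_apply, smul_eq_mul] at this
    simp only [Matrix.mulVec, dotProduct, Pi.zero_apply, Matrix.projVandermonde_apply, Fin.val_rev]
    rw [← this]
    refine sum_congr rfl fun j _ => ?_
    rw [show m + 1 - ((j : ℕ) + 1) = m - j by omega]
    ring
  simp [hc]

/-- Two points at which `G₀ : G₁` differ, in terms of the kernel `θ(bz) θ(Kz/b)`. -/
lemma forms_independent {p : ℂ} (hp : ‖p‖ < 1) {K : ℂ} {G₀ G₁ H₀ H₁ : ℂ → ℂ}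
    (hG : ∀ b z, b ≠ 0 → z ≠ 0 → theta p (b * z) * theta p (K * z / b) = G₀ b * H₀ z + G₁ b * H₁ z)
    {b b' : ℂ} (hb : b ≠ 0) (hb' : b' ≠ 0) (h1 : theta p (b / b') ≠ 0)
    (h2 : theta p (K / (b * b')) ≠ 0) : G₀ b * G₁ b' ≠ G₁ b * G₀ b' := by
  -- At z = 1/b' the kernel vanishes for the parameter b', since θ(1) = 0, but not for b. If the
  -- determinant were zero, this would force G₀ and G₁ to vanish at b', and then the kernel at (b',
  -- 1/b) would vanish too.
  intro h
  have e1 := hG b' b'⁻¹ hb' (inv_ne_zero hb')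
  have e2 := hG b b'⁻¹ hb (inv_ne_zero hb')
  have e3 := hG b' b⁻¹ hb' (inv_ne_zero hb)
  rw [mul_inv_cancel₀ hb', theta_one hp, zero_mul] at e1
  rw [← div_eq_mul_inv, ← div_eq_mul_inv, div_div, mul_comm b' b] at e2
  rw [← div_eq_mul_inv, ← div_eq_mul_inv, div_div, ← inv_div, theta_inv hp (div_ne_zero hb hb')] at e3
  have h3 := mul_ne_zero h1 h2
  have z0 : G₀ b' = 0 := by
    refine (mul_eq_zero.mp (?_ : G₀ b' * (theta p (b / b') * theta p (K / (b * b'))) = 0)).resolve_right h3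
    rw [e2]
    linear_combination -G₀ b * e1 - H₁ b'⁻¹ * h
  have z1 : G₁ b' = 0 := by
    refine (mul_eq_zero.mp (?_ : G₁ b' * (theta p (b / b') * theta p (K / (b * b'))) = 0)).resolve_right h3
    rw [e2]
    linear_combination -G₁ b * e1 + H₀ b'⁻¹ * h
  rw [z0, z1, zero_mul, zero_mul, add_zero, mul_assoc] at e3
  exact mul_ne_zero (neg_ne_zero.mpr (inv_ne_zero (div_ne_zero hb hb'))) h3 e3

/-! ### Passing to generic parameters -/

/-- The complement of a countable set is dense in ℂ. -/
lemma eq_of_eqOn_compl_countable {f g : ℂ → ℂ} {z : ℂ} (hf : ContinuousAt f z)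
    (hg : ContinuousAt g z) {s : Set ℂ} (hs : s.Countable) (h : ∀ w ∉ s, f w = g w) :
    f z = g z := by
  have hz : z ∈ closure sᶜ := (hs.dense_compl ℂ) z
  have : Filter.NeBot (nhdsWithin z sᶜ) := mem_closure_iff_nhdsWithin_neBot.mp hz
  refine tendsto_nhds_unique_of_eventuallyEq (l := nhdsWithin z sᶜ) (hf.tendsto.mono_left nhdsWithin_le_nhds)
    (hg.tendsto.mono_left nhdsWithin_le_nhds) ?_
  filter_upwards [self_mem_nhdsWithin] with w hw using h w hw

lemma countable_theta_div_eq_zero {p : ℂ} (hp : ‖p‖ < 1) {z : ℂ} (hz : z ≠ 0) :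
    {w : ℂ | theta p (z / w) = 0}.Countable := by
  refine ((Set.countable_range fun m : ℤ => z / p ^ m).union (Set.countable_singleton 0)).mono ?_
  intro w hw
  by_cases hw0 : w = 0
  · exact Or.inr hw0
  · obtain ⟨m, hm⟩ := theta_eq_zero hp (div_ne_zero hz hw0) hw
    refine Or.inl ⟨m, ?_⟩
    simp only [← hm]
    field_simp

lemma continuousAt_theta_comp {p : ℂ} (hp : ‖p‖ < 1) {g : ℂ → ℂ} {z : ℂ} (hg : ContinuousAt g z)
    (h0 : g z ≠ 0) : ContinuousAt (fun w => theta p (g w)) z :=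
  ContinuousAt.comp' (continuousAt_theta hp h0) hg

/-! ### A sum over subsets -/

/-- The product of `f u v` over the pairs in `S` with `R u v`. -/
def pairProd {ι : Type*} (R : ι → ι → Prop) [DecidableRel R] (f : ι → ι → ℂ) (S : Finset ι) : ℂ :=
  ∏ u ∈ S, ∏ v ∈ S, if R u v then f u v else 1

/-- The relation `R` contains exactly one of `(u, v)` and `(v, u)` for all `u ≠ v`. -/
def IsOrientation {ι : Type*} (R : ι → ι → Prop) : Prop :=
  (∀ u, ¬ R u u) ∧ ∀ u v, u ≠ v → (R u v ↔ ¬ R v u)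

/-- Exactly one of the pairs (u, w), (w, u) is counted, and f is symmetric, so w contributes `f u w`
once for each u. -/
lemma pairProd_insert {ι : Type*} [DecidableEq ι] {R : ι → ι → Prop} [DecidableRel R]
    (hR : IsOrientation R) {f : ι → ι → ℂ} (hf : ∀ u v, f u v = f v u) {S : Finset ι} {w : ι}
    (hw : w ∉ S) : pairProd R f (insert w S) = pairProd R f S * ∏ u ∈ S, f u w := by
  have h : ∀ u ∈ S, f u w = (if R w u then f w u else 1) * if R u w then f u w else 1 := by
    intro u hu
    have := hR.2 w u (fun h => hw (h ▸ hu))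
    by_cases h1 : R w u
    · simp [h1, this.mp h1, hf]
    · have h2 : R u w := by tauto
      simp [h1, h2]
  unfold pairProd
  rw [prod_insert hw, prod_insert hw, if_neg (hR.1 w), one_mul, prod_congr rfl h, prod_mul_distrib]
  simp_rw [prod_insert hw]
  rw [prod_mul_distrib]
  ring

lemma mul_mul_div_cancel_head {x c d z : ℂ} (hx : x ≠ 0) : x * c * d * (z / x) = z * c * d := by
  field_simp

section SubsetSum

variable {ι : Type*} [DecidableEq ι]

/-- The summand of the sum over the subsets `S` of `T`. -/
noncomputable def subsetTerm (R : ι → ι → Prop) [DecidableRel R] (p A q : ℂ) (y : ι → ℂ)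
    (T : Finset ι) (b c d e : ℂ) (S : Finset ι) : ℂ :=
  (-1) ^ #S * (q ^ (#S).choose 2)⁻¹
    * (∏ u ∈ S, (theta p (b * y u) * theta p (c * y u) * (theta p (d * y u) * theta p (e * y u))))
    * (∏ v ∈ T \ S, (theta p (A * y v / b) * theta p (A * y v / c)
        * (theta p (A * y v / d) * theta p (A * y v / e))))
    * (∏ u ∈ S, ∏ v ∈ T \ S, theta p (y u / (q * y v)) / theta p (y u / y v))
    * pairProd R (fun u v => theta p (A * (y u * y v) / q) / theta p (A * (y u * y v))) S
    * pairProd R (fun u v => theta p (A * (y u * y v) * q) / theta p (A * (y u * y v))) (T \ S)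

/-- The closed form of the sum over the subsets of `T`. -/
noncomputable def subsetSum (p A q : ℂ) (y : ι → ℂ) (T : Finset ι) (b c d : ℂ) : ℂ :=
  (∏ u ∈ T, (theta p (A * y u ^ 2) * (-(b * c * d * y u / A)))) * (q ^ (#T * (#T - 1)))⁻¹
    * (∏ i ∈ range #T, theta p (A * q ^ i / (b * c))) * (∏ i ∈ range #T, theta p (A * q ^ i / (b * d)))
    * ∏ i ∈ range #T, theta p (A * q ^ i / (c * d))

variable {R : ι → ι → Prop} [DecidableRel R] {p A q : ℂ} {y : ι → ℂ}

/-- In the two products that contain b the factor i = 0 splits off and the others absorb q into b/q;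
in the product with c and d the last factor splits off. -/
lemma subsetSum_insert (hq : q ≠ 0) {T : Finset ι} {w : ι} (hw : w ∉ T) (b c d : ℂ) :
    subsetSum p A q y (insert w T) b c d =
      theta p (A * y w ^ 2) * (-(b * c * d * y w / A)) * (q ^ #T)⁻¹ * theta p (A / (b * c))
        * theta p (A / (b * d)) * theta p (A * q ^ #T / (c * d))
        * subsetSum p A q y T (b / q) c d := by
  have e1 : ∀ c' : ℂ, ∏ i ∈ range (#T + 1), theta p (A * q ^ i / (b * c')) =
      (∏ i ∈ range #T, theta p (A * q ^ i / (b / q * c'))) * theta p (A / (b * c')) := by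
    intro c'
    rw [prod_range_succ', pow_zero, mul_one]
    congr 1
    refine prod_congr rfl fun i _ => ?_
    congr 1
    rw [pow_succ, div_mul_eq_mul_div, div_div_eq_mul_div, mul_assoc]
  have e2 : ∏ u ∈ T, (theta p (A * y u ^ 2) * (-(b * c * d * y u / A))) =
      q ^ #T * ∏ u ∈ T, (theta p (A * y u ^ 2) * (-(b / q * c * d * y u / A))) := by
    rw [← prod_const, ← prod_mul_distrib]
    refine prod_congr rfl fun u _ => ?_
    field_simp
  have e3 : (q ^ ((#T + 1) * (#T + 1 - 1)))⁻¹ = (q ^ #T)⁻¹ * (q ^ #T)⁻¹ * (q ^ (#T * (#T - 1)))⁻¹ := by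
    rw [← mul_inv, ← mul_inv, ← pow_add, ← pow_add]
    congr 2
    rcases #T with _ | m
    · rfl
    · simp only [Nat.add_sub_cancel]
      ring
  unfold subsetSum
  have hQ : q ^ #T ≠ 0 := pow_ne_zero _ hq
  rw [prod_insert hw, card_insert_of_notMem hw, e1, e1, prod_range_succ, e2, e3]
  generalize q ^ #T = Q at hQ
  generalize (q ^ (#T * (#T - 1)))⁻¹ = Z
  generalize ∏ u ∈ T, (theta p (A * y u ^ 2) * (-(b / q * c * d * y u / A))) = P
  generalize theta p (A * y w ^ 2) * (-(b * c * d * y w / A)) = t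
  have hQ' : Q * Q⁻¹ = 1 := mul_inv_cancel₀ hQ
  linear_combination (t * P * Q⁻¹ * Z
    * ((∏ i ∈ range #T, theta p (A * q ^ i / (b / q * c))) * theta p (A / (b * c)))
    * ((∏ i ∈ range #T, theta p (A * q ^ i / (b / q * d))) * theta p (A / (b * d)))
    * ((∏ i ∈ range #T, theta p (A * q ^ i / (c * d))) * theta p (A * Q / (c * d)))) * hQ'

/-- At b = 1/y_w the factors θ(b y_u) and θ(A y_v/b) are the denominators of the pair factors that
involve w. The cancellation leaves the numerators, which are the same factors with b/q in place of
b. -/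
lemma subsetTerm_insert_left (hq : q ≠ 0) (hA : A ≠ 0)
    (hR : IsOrientation R) {T S : Finset ι} {w : ι} (hw : w ∉ T) (hS : S ⊆ T)
    (hyy : ∀ u ∈ insert w T, ∀ v ∈ insert w T, u ≠ v → theta p (y u / y v) ≠ 0)
    (hAyy : ∀ u ∈ insert w T, ∀ v ∈ insert w T, theta p (A * (y u * y v)) ≠ 0)
    {b c d e : ℂ} (hb : b * y w = 1) :
    subsetTerm R p A q y (insert w T) b c d e S =
      theta p (A * y w ^ 2) * (theta p (A * y w / c) * theta p (A * y w / d) * theta p (A * y w / e))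
        * subsetTerm R p A q y T (b / q) c d e S := by
  have hwS : w ∉ S := fun h => hw (hS h)
  have hb0 : b ≠ 0 := left_ne_zero_of_mul_eq_one hb
  have hbw : b = (y w)⁻¹ := eq_inv_of_mul_eq_one_left hb
  have hT : insert w T \ S = insert w (T \ S) := insert_sdiff_of_notMem _ hwS
  have hw' : w ∉ T \ S := fun h => hw (mem_sdiff.mp h).1
  unfold subsetTerm
  rw [hT, prod_insert hw', pairProd_insert hR (fun u v => by rw [mul_comm (y u)]) hw']
  have e0 : ∏ u ∈ S, ∏ v ∈ insert w (T \ S), theta p (y u / (q * y v)) / theta p (y u / y v) =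
      (∏ u ∈ S, theta p (y u / (q * y w)) / theta p (y u / y w)) *
        ∏ u ∈ S, ∏ v ∈ T \ S, theta p (y u / (q * y v)) / theta p (y u / y v) := by
    rw [← prod_mul_distrib]
    exact prod_congr rfl fun u _ => prod_insert hw'
  rw [e0]
  have e1 : (∏ u ∈ S, (theta p (b * y u) * theta p (c * y u) * (theta p (d * y u) * theta p (e * y u))))
      * (∏ u ∈ S, theta p (y u / (q * y w)) / theta p (y u / y w)) =
      ∏ u ∈ S, (theta p (b / q * y u) * theta p (c * y u) * (theta p (d * y u) * theta p (e * y u))) := by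
    rw [← prod_mul_distrib]
    refine prod_congr rfl fun u hu => ?_
    have h := hyy u (mem_insert_of_mem (hS hu)) w (mem_insert_self _ _) (fun h => hwS (h ▸ hu))
    rw [show b * y u = y u / y w by rw [hbw]; ring,
      show b / q * y u = y u / (q * y w) by rw [hbw]; field_simp]
    exact mul_mul_div_cancel_head h
  have e2 : (∏ v ∈ T \ S, (theta p (A * y v / b) * theta p (A * y v / c)
        * (theta p (A * y v / d) * theta p (A * y v / e))))
      * (∏ v ∈ T \ S, theta p (A * (y v * y w) * q) / theta p (A * (y v * y w))) =
      ∏ v ∈ T \ S, (theta p (A * y v / (b / q)) * theta p (A * y v / c)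
        * (theta p (A * y v / d) * theta p (A * y v / e))) := by
    rw [← prod_mul_distrib]
    refine prod_congr rfl fun v hv => ?_
    have h := hAyy v (mem_insert_of_mem (mem_sdiff.mp hv).1) w (mem_insert_self _ _)
    rw [show A * y v / b = A * (y v * y w) by rw [hbw]; field_simp,
      show A * y v / (b / q) = A * (y v * y w) * q by rw [hbw]; field_simp]
    exact mul_mul_div_cancel_head h
  rw [← e1, ← e2, show A * y w / b = A * y w ^ 2 by rw [hbw]; field_simp]
  ring

/-- At b = A y_w the cancellation takes place against the pairs inside S and, after inverting theta,
against the pairs (w, v) with v ∉ S. The inversions give q^(-#(T \ S)), the binomial exponent gives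
q^(-#S), and the product q^(-#T) does not depend on S. -/
lemma subsetTerm_insert_right (hp : ‖p‖ < 1) (hq : q ≠ 0) (hA : A ≠ 0) (hy : ∀ u, y u ≠ 0)
    (hR : IsOrientation R) {T S : Finset ι} {w : ι} (hw : w ∉ T) (hS : S ⊆ T)
    (hyy : ∀ u ∈ insert w T, ∀ v ∈ insert w T, u ≠ v → theta p (y u / y v) ≠ 0)
    (hAyy : ∀ u ∈ insert w T, ∀ v ∈ insert w T, theta p (A * (y u * y v)) ≠ 0)
    {b c d e : ℂ} (hb : b = A * y w) :
    subsetTerm R p A q y (insert w T) b c d e (insert w S) =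
      -(q ^ #T)⁻¹ * theta p (A * y w ^ 2)
        * (theta p (c * y w) * theta p (d * y w) * theta p (e * y w))
        * subsetTerm R p A q y T (b / q) c d e S := by
  have hwS : w ∉ S := fun h => hw (hS h)
  have hT : insert w T \ insert w S = T \ S := by
    rw [insert_sdiff_of_mem _ (mem_insert_self _ _), sdiff_insert_of_notMem hw]
  unfold subsetTerm
  rw [hT, prod_insert hwS, prod_insert hwS, card_insert_of_notMem hwS,
    pairProd_insert hR (fun u v => by rw [mul_comm (y u)]) hwS]
  have e1 : (∏ u ∈ S, (theta p (b * y u) * theta p (c * y u) * (theta p (d * y u) * theta p (e * y u))))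
      * (∏ u ∈ S, theta p (A * (y u * y w) / q) / theta p (A * (y u * y w))) =
      ∏ u ∈ S, (theta p (b / q * y u) * theta p (c * y u) * (theta p (d * y u) * theta p (e * y u))) := by
    rw [← prod_mul_distrib]
    refine prod_congr rfl fun u hu => ?_
    have h := hAyy u (mem_insert_of_mem (hS hu)) w (mem_insert_self _ _)
    rw [show b * y u = A * (y u * y w) by rw [hb]; ring,
      show b / q * y u = A * (y u * y w) / q by rw [hb]; field_simp]
    exact mul_mul_div_cancel_head h
  have e2 : (∏ v ∈ T \ S, (theta p (A * y v / b) * theta p (A * y v / c)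
        * (theta p (A * y v / d) * theta p (A * y v / e))))
      * (∏ v ∈ T \ S, theta p (y w / (q * y v)) / theta p (y w / y v)) =
      (q ^ #(T \ S))⁻¹ * ∏ v ∈ T \ S, (theta p (A * y v / (b / q)) * theta p (A * y v / c)
        * (theta p (A * y v / d) * theta p (A * y v / e))) := by
    rw [← inv_pow, ← prod_const, ← prod_mul_distrib, ← prod_mul_distrib]
    refine prod_congr rfl fun v hv => ?_
    have hvT := (mem_sdiff.mp hv).1
    have h := hyy w (mem_insert_self _ _) v (mem_insert_of_mem hvT) (fun h => hw (h ▸ hvT))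
    have hv0 := hy v
    have hw0 := hy w
    rw [show A * y v / b = y v / y w by rw [hb]; field_simp,
      show A * y v / (b / q) = q * y v / y w by rw [hb]; field_simp,
      theta_eq_neg_mul hp (z := y v / y w) (w := y w / y v) (by positivity) (by field_simp),
      theta_eq_neg_mul hp (z := q * y v / y w) (w := y w / (q * y v)) (by positivity) (by field_simp)]
    field_simp
  have e3 : (q ^ (#S + 1).choose 2)⁻¹ * (q ^ #(T \ S))⁻¹ = (q ^ #T)⁻¹ * (q ^ (#S).choose 2)⁻¹ := by
    rw [← mul_inv, ← mul_inv, ← pow_add, ← pow_add, Nat.choose_succ_succ' (#S) 1, Nat.choose_one_right,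
      ← card_sdiff_add_card_eq_card hS]
    congr 2
    ring
  have e4 : ∀ X : ℂ, (-1) ^ (#S + 1) * (q ^ (#S + 1).choose 2)⁻¹ * ((q ^ #(T \ S))⁻¹ * X) =
      -(q ^ #T)⁻¹ * ((-1) ^ #S * (q ^ (#S).choose 2)⁻¹ * X) := by
    intro X
    rw [pow_succ]
    linear_combination (-1) ^ #S * (-1) * X * e3
  rw [← e1, show b * y w = A * y w ^ 2 by rw [hb]; ring]
  generalize ∏ u ∈ S, (theta p (b * y u) * theta p (c * y u) * (theta p (d * y u) * theta p (e * y u)))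
    = X₁
  generalize ∏ u ∈ S, theta p (A * (y u * y w) / q) / theta p (A * (y u * y w)) = X₂
  generalize ∏ v ∈ T \ S, (theta p (A * y v / b) * theta p (A * y v / c)
    * (theta p (A * y v / d) * theta p (A * y v / e))) = X₃ at e2 ⊢
  generalize ∏ v ∈ T \ S, theta p (y w / (q * y v)) / theta p (y w / y v) = X₄ at e2 ⊢
  generalize ∏ v ∈ T \ S, (theta p (A * y v / (b / q)) * theta p (A * y v / c)
    * (theta p (A * y v / d) * theta p (A * y v / e))) = X₅ at e2 ⊢
  generalize ∏ u ∈ S, ∏ v ∈ T \ S, theta p (y u / (q * y v)) / theta p (y u / y v) = X₆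
  generalize pairProd R _ S = X₇
  generalize pairProd R _ (T \ S) = X₈
  generalize theta p (A * y w ^ 2) = t₁
  generalize theta p (c * y w) = t₂
  generalize theta p (d * y w) = t₃
  generalize theta p (e * y w) = t₄
  linear_combination ((-1) ^ (#S + 1) * (q ^ (#S + 1).choose 2)⁻¹ * (t₁ * t₂ * t₃ * t₄ * X₁ * X₂ * X₆
    * X₇ * X₈)) * e2 + (t₁ * t₂ * t₃ * t₄ * X₁ * X₂ * X₆ * X₇ * X₈) * e4 X₅

end SubsetSum

/-! ### Evaluation of the sum over subsets by interpolation in b -/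

section SubsetSum

variable {ι : Type*} [DecidableEq ι] {R : ι → ι → Prop} [DecidableRel R] {p A q : ℂ} {y : ι → ℂ}

lemma sum_subsetTerm_insert_left (hp : ‖p‖ < 1) (hq : q ≠ 0) (hA : A ≠ 0)
    (hR : IsOrientation R) {T : Finset ι} {w : ι} (hw : w ∉ T)
    (hyy : ∀ u ∈ insert w T, ∀ v ∈ insert w T, u ≠ v → theta p (y u / y v) ≠ 0)
    (hAyy : ∀ u ∈ insert w T, ∀ v ∈ insert w T, theta p (A * (y u * y v)) ≠ 0)
    {b c d e : ℂ} (hc : c ≠ 0) (hd : d ≠ 0) (he : e ≠ 0) (hb : b * y w = 1)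
    (hbal : b * c * d * e = A ^ 2 * q ^ #T)
    (ih : ∑ S ∈ T.powerset, subsetTerm R p A q y T (b / q) c d e S =
      subsetSum p A q y T (b / q) c d) :
    ∑ S ∈ (insert w T).powerset, subsetTerm R p A q y (insert w T) b c d e S =
      subsetSum p A q y (insert w T) b c d := by
  have hb0 : b ≠ 0 := left_ne_zero_of_mul_eq_one hb
  have hw0 : y w ≠ 0 := right_ne_zero_of_mul_eq_one hb
  have hbw : b = (y w)⁻¹ := eq_inv_of_mul_eq_one_left hb
  have hqT : q ^ #T ≠ 0 := pow_ne_zero _ hq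
  rw [sum_powerset_insert hw, subsetSum_insert hq hw, ← ih]
  -- Since b y_w = 1, each S that contains w contributes a factor θ(1) = 0.
  have h0 : ∑ S ∈ T.powerset, subsetTerm R p A q y (insert w T) b c d e (insert w S) = 0 := by
    refine sum_eq_zero fun S _ => ?_
    unfold subsetTerm
    rw [prod_eq_zero (mem_insert_self w S) (by rw [hb, theta_one hp]; ring)]
    ring
  rw [h0, add_zero, sum_congr rfl fun S hS =>
    subsetTerm_insert_left hq hA hR hw (mem_powerset.mp hS) hyy hAyy hb, ← mul_sum]
  congr 1
  -- The balancing condition makes A y_w/e and A q^#T/(cd) reciprocal.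
  have e1 : theta p (A * y w / e) = -(A * y w / e) * theta p (A * q ^ #T / (c * d)) := by
    refine theta_eq_neg_mul hp (by positivity) ?_
    field_simp
    rw [hbw] at hbal
    field_simp at hbal
    linear_combination -hbal
  have e2 : A * y w / e = b * c * d * y w / A * (q ^ #T)⁻¹ := by
    field_simp
    linear_combination -hbal
  rw [e1, e2, show A / (b * c) = A * y w / c by rw [hbw]; field_simp,
    show A / (b * d) = A * y w / d by rw [hbw]; field_simp]
  ring

lemma sum_subsetTerm_insert_right (hp : ‖p‖ < 1) (hq : q ≠ 0) (hA : A ≠ 0) (hy : ∀ u, y u ≠ 0)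
    (hR : IsOrientation R) {T : Finset ι} {w : ι} (hw : w ∉ T)
    (hyy : ∀ u ∈ insert w T, ∀ v ∈ insert w T, u ≠ v → theta p (y u / y v) ≠ 0)
    (hAyy : ∀ u ∈ insert w T, ∀ v ∈ insert w T, theta p (A * (y u * y v)) ≠ 0)
    {b c d e : ℂ} (hc : c ≠ 0) (hd : d ≠ 0) (hb : b = A * y w)
    (hbal : b * c * d * e = A ^ 2 * q ^ #T)
    (ih : ∑ S ∈ T.powerset, subsetTerm R p A q y T (b / q) c d e S =
      subsetSum p A q y T (b / q) c d) :
    ∑ S ∈ (insert w T).powerset, subsetTerm R p A q y (insert w T) b c d e S =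
      subsetSum p A q y (insert w T) b c d := by
  have hw0 : y w ≠ 0 := hy w
  have hqT : q ^ #T ≠ 0 := pow_ne_zero _ hq
  rw [sum_powerset_insert hw, subsetSum_insert hq hw, ← ih]
  -- Since A y_w/b = 1, the factor θ(1) = 0 now comes from the sets that miss w.
  have h0 : ∑ S ∈ T.powerset, subsetTerm R p A q y (insert w T) b c d e S = 0 := by
    refine sum_eq_zero fun S hS => ?_
    have hwS : w ∈ insert w T \ S :=
      mem_sdiff.mpr ⟨mem_insert_self _ _, fun h => hw (mem_powerset.mp hS h)⟩
    unfold subsetTerm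
    rw [prod_eq_zero hwS (by rw [hb, div_self (mul_ne_zero hA hw0), theta_one hp]; ring)]
    ring
  rw [h0, zero_add, sum_congr rfl fun S hS =>
    subsetTerm_insert_right hp hq hA hy hR hw (mem_powerset.mp hS) hyy hAyy hb, ← mul_sum]
  congr 1
  have e1 : ∀ z : ℂ, z ≠ 0 → theta p (A / (b * z)) = -(z * y w)⁻¹ * theta p (z * y w) := by
    intro z hz
    rw [← theta_inv hp (mul_ne_zero hz hw0), hb]
    congr 1
    field_simp
  have e2 : A * q ^ #T / (c * d) = e * y w := by
    rw [hb] at hbal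
    field_simp
    apply mul_left_cancel₀ hA
    linear_combination -hbal
  rw [e1 c hc, e1 d hd, e2, hb]
  field_simp

/-- Each u ∈ S gives the kernel θ(bz) θ(Kz/b) at z = y_u, and each v ∉ S gives it at z = 1/(A y_v),
up to a factor free of b. So every term has the same degree #S + #(T \ S) = #T. -/
lemma sum_subsetTerm_mem_forms (hp : ‖p‖ < 1) (hA : A ≠ 0) (hy : ∀ u, y u ≠ 0) {K : ℂ} (hK : K ≠ 0)
    {G₀ G₁ H₀ H₁ : ℂ → ℂ}
    (hG : ∀ b z, b ≠ 0 → z ≠ 0 → theta p (b * z) * theta p (K * z / b) = G₀ b * H₀ z + G₁ b * H₁ z)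
    (T : Finset ι) (c d : ℂ) :
    (fun b : ℂˣ => ∑ S ∈ T.powerset, subsetTerm R p A q y T b c d (K / b) S) ∈ forms G₀ G₁ #T := by
  have hsum : (fun b : ℂˣ => ∑ S ∈ T.powerset, subsetTerm R p A q y T b c d (K / b) S) =
      ∑ S ∈ T.powerset, fun b : ℂˣ => subsetTerm R p A q y T b c d (K / b) S := by
    funext b
    simp
  rw [hsum]
  refine Submodule.sum_mem _ fun S hS => ?_
  have hcard : #S + #(T \ S) = #T := by
    rw [add_comm, card_sdiff_add_card_eq_card (mem_powerset.mp hS)]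
  let C : ℂ := (-1) ^ #S * (q ^ (#S).choose 2)⁻¹
    * (∏ u ∈ S, theta p (c * y u) * theta p (d * y u))
    * (∏ v ∈ T \ S, (theta p (A * y v / c) * theta p (A * y v / d) * (A ^ 2 * y v ^ 2 / K)))
    * (∏ u ∈ S, ∏ v ∈ T \ S, theta p (y u / (q * y v)) / theta p (y u / y v))
    * pairProd R (fun u v => theta p (A * (y u * y v) / q) / theta p (A * (y u * y v))) S
    * pairProd R (fun u v => theta p (A * (y u * y v) * q) / theta p (A * (y u * y v))) (T \ S)
  have h1 := mul_prod_mem_forms (ι := ι) (φ := fun b u => theta p (b * y u) * theta p (K * y u / b))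
    (fun b u => hG b (y u) b.ne_zero (hy u)) (const_mem_forms C) S (zero_add #S)
  have h2 := mul_prod_mem_forms (ι := ι)
    (φ := fun b u => theta p (b * (A * y u)⁻¹) * theta p (K * (A * y u)⁻¹ / b))
    (fun b u => hG b (A * y u)⁻¹ b.ne_zero (inv_ne_zero (mul_ne_zero hA (hy u)))) h1 (T \ S) hcard
  convert h2 using 1
  funext b
  have hb : (b : ℂ) ≠ 0 := b.ne_zero
  have e1 : ∏ u ∈ S, (theta p (b * y u) * theta p (c * y u) * (theta p (d * y u) * theta p (K / b * y u)))
      = (∏ u ∈ S, theta p (c * y u) * theta p (d * y u)) *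
        ∏ u ∈ S, theta p (b * y u) * theta p (K * y u / b) := by
    rw [← prod_mul_distrib]
    refine prod_congr rfl fun u _ => ?_
    rw [div_mul_eq_mul_div]
    ring
  have e2 : ∏ v ∈ T \ S, (theta p (A * y v / b) * theta p (A * y v / c)
        * (theta p (A * y v / d) * theta p (A * y v / (K / b))))
      = (∏ v ∈ T \ S, (theta p (A * y v / c) * theta p (A * y v / d) * (A ^ 2 * y v ^ 2 / K))) *
        ∏ v ∈ T \ S, (theta p (b * (A * y v)⁻¹) * theta p (K * (A * y v)⁻¹ / b)) := by
    rw [← prod_mul_distrib]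
    refine prod_congr rfl fun v _ => ?_
    have hv := hy v
    rw [theta_eq_neg_mul hp (z := A * y v / b) (w := b * (A * y v)⁻¹) (by positivity) (by field_simp),
      theta_eq_neg_mul hp (z := A * y v / (K / b)) (w := K * (A * y v)⁻¹ / b) (by positivity)
        (by field_simp)]
    field_simp
  simp only [C]
  unfold subsetTerm
  rw [e1, e2]
  ring

omit [DecidableEq ι] in
-- By the balancing condition the product with 1/(bd), read backwards, pairs with the product with
-- 1/(bc): the i-th factors form the kernel at z = c/(A q^i). The power b^#T absorbs the monomials
-- from inverting theta.
lemma subsetSum_mem_forms (hp : ‖p‖ < 1) (hq : q ≠ 0) (hA : A ≠ 0) {K : ℂ} {G₀ G₁ H₀ H₁ : ℂ → ℂ}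
    (hG : ∀ b z, b ≠ 0 → z ≠ 0 → theta p (b * z) * theta p (K * z / b) = G₀ b * H₀ z + G₁ b * H₁ z)
    (T : Finset ι) {c d : ℂ} (hc : c ≠ 0) (hd : d ≠ 0) (hbal : K * c * d * q = A ^ 2 * q ^ #T) :
    (fun b : ℂˣ => subsetSum p A q y T b c d) ∈ forms G₀ G₁ #T := by
  let C : ℂ := (∏ u ∈ T, (theta p (A * y u ^ 2) * (-(c * d * y u / A)))) * (q ^ (#T * (#T - 1)))⁻¹
    * (∏ i ∈ range #T, -(c / (A * q ^ i))⁻¹) * ∏ i ∈ range #T, theta p (A * q ^ i / (c * d))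
  have hz : ∀ i : ℕ, c / (A * q ^ i) ≠ 0 := fun i => by positivity
  have h1 := mul_prod_mem_forms (ι := ℕ)
    (φ := fun b i => theta p (b * (c / (A * q ^ i))) * theta p (K * (c / (A * q ^ i)) / b))
    (fun b i => hG b (c / (A * q ^ i)) b.ne_zero (hz i)) (const_mem_forms C) (range #T)
    (k := #T) (by simp)
  convert h1 using 1
  funext b
  have hb : (b : ℂ) ≠ 0 := b.ne_zero
  have e1 : ∏ u ∈ T, (theta p (A * y u ^ 2) * (-(b * c * d * y u / A))) =
      (b : ℂ) ^ #T * ∏ u ∈ T, (theta p (A * y u ^ 2) * (-(c * d * y u / A))) := by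
    rw [← prod_const, ← prod_mul_distrib]
    exact prod_congr rfl fun u _ => by ring
  have e2 : ∏ i ∈ range #T, theta p (A * q ^ i / (b * d)) =
      ∏ i ∈ range #T, theta p (K * (c / (A * q ^ i)) / b) := by
    rw [← prod_range_reflect]
    refine prod_congr rfl fun i hi => ?_
    have hi' : q ^ #T = q ^ (#T - 1 - i) * q ^ i * q := by
      rw [← pow_add, ← pow_succ]
      congr 1
      have := mem_range.mp hi
      omega
    congr 1
    field_simp
    apply mul_right_cancel₀ hq
    rw [hi'] at hbal
    linear_combination -hbal
  have e3 : (b : ℂ) ^ #T * ∏ i ∈ range #T, theta p (A * q ^ i / (b * c)) =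
      (∏ i ∈ range #T, -(c / (A * q ^ i))⁻¹) * ∏ i ∈ range #T, theta p (b * (c / (A * q ^ i))) := by
    rw [← card_range #T, ← prod_const, card_range, ← prod_mul_distrib, ← prod_mul_distrib]
    refine prod_congr rfl fun i _ => ?_
    rw [theta_eq_neg_mul hp (z := A * q ^ i / (b * c)) (w := b * (c / (A * q ^ i))) (by positivity)
      (by field_simp)]
    field_simp
  simp only [C]
  unfold subsetSum
  rw [e1, e2, prod_mul_distrib (s := range #T)]
  linear_combination ((∏ u ∈ T, (theta p (A * y u ^ 2) * (-(c * d * y u / A))))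
    * (q ^ (#T * (#T - 1)))⁻¹ * (∏ i ∈ range #T, theta p (K * (c / (A * q ^ i)) / b))
    * ∏ i ∈ range #T, theta p (A * q ^ i / (c * d))) * e3

lemma continuousAt_sum_subsetTerm (hp : ‖p‖ < 1) (hA : A ≠ 0) (hy : ∀ u, y u ≠ 0) (T : Finset ι)
    (b c : ℂ) {L d : ℂ} (hL : L ≠ 0) (hd : d ≠ 0) :
    ContinuousAt (fun d => ∑ S ∈ T.powerset, subsetTerm R p A q y T b c d (L / d) S) d := by
  refine tendsto_finsetSum _ fun S _ => ?_
  unfold subsetTerm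
  have hLd : L / d ≠ 0 := div_ne_zero hL hd
  have c1 : ContinuousAt (fun d : ℂ => L / d) d := continuousAt_const.div continuousAt_id hd
  refine ((((ContinuousAt.mul continuousAt_const ?_).mul ?_).mul continuousAt_const).mul
    continuousAt_const).mul continuousAt_const
  · refine tendsto_finsetProd _ fun u _ => ?_
    refine ContinuousAt.mul continuousAt_const (ContinuousAt.mul ?_ ?_)
    · exact continuousAt_theta_comp hp (continuousAt_id.mul continuousAt_const) (mul_ne_zero hd (hy u))
    · exact continuousAt_theta_comp hp (c1.mul continuousAt_const) (mul_ne_zero hLd (hy u))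
  · refine tendsto_finsetProd _ fun u _ => ?_
    have hu := hy u
    refine ContinuousAt.mul continuousAt_const (ContinuousAt.mul ?_ ?_)
    · exact continuousAt_theta_comp hp (continuousAt_const.div continuousAt_id hd)
        (div_ne_zero (mul_ne_zero hA (hy u)) hd)
    · exact continuousAt_theta_comp hp (continuousAt_const.div c1 hLd)
        (div_ne_zero (mul_ne_zero hA (hy u)) hLd)

omit [DecidableEq ι] in
lemma continuousAt_subsetSum (hp : ‖p‖ < 1) (hq : q ≠ 0) (hA : A ≠ 0) (T : Finset ι)
    {b c d : ℂ} (hb : b ≠ 0) (hc : c ≠ 0) (hd : d ≠ 0) :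
    ContinuousAt (fun d => subsetSum p A q y T b c d) d := by
  unfold subsetSum
  have key : ∀ z : ℂ, z ≠ 0 → ContinuousAt
      (fun d => ∏ i ∈ range #T, theta p (A * q ^ i / (z * d))) d := by
    intro z hz
    refine tendsto_finsetProd _ fun i _ => ?_
    have hzd := mul_ne_zero hz hd
    exact continuousAt_theta_comp hp
      (continuousAt_const.div (continuousAt_const.mul continuousAt_id) hzd)
      (div_ne_zero (mul_ne_zero hA (pow_ne_zero _ hq)) hzd)
  refine (((ContinuousAt.mul ?_ continuousAt_const).mul continuousAt_const).mul (key b hb)).mul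
    (key c hc)
  refine tendsto_finsetProd _ fun u _ => ?_
  have : ContinuousAt (fun d => theta p (A * y u ^ 2) * -(b * c * d * y u / A)) d := by fun_prop
  exact this

/-- The elliptic `C_n` Jackson summation in the case when all the upper limits are one. -/
theorem sum_subsetTerm (hp : ‖p‖ < 1) (hq : q ≠ 0) (hA : A ≠ 0) (hy : ∀ u, y u ≠ 0)
    (hR : IsOrientation R) (T : Finset ι) :
    (∀ u ∈ T, ∀ v ∈ T, u ≠ v → theta p (y u / y v) ≠ 0) →
    (∀ u ∈ T, ∀ v ∈ T, theta p (A * (y u * y v)) ≠ 0) →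
    ∀ b c d e : ℂ, b ≠ 0 → c ≠ 0 → d ≠ 0 → e ≠ 0 → b * c * d * e * q = A ^ 2 * q ^ #T →
    ∑ S ∈ T.powerset, subsetTerm R p A q y T b c d e S = subsetSum p A q y T b c d := by
  induction hm : #T generalizing T with
  | zero =>
    intros
    rw [card_eq_zero] at hm
    subst hm
    simp [subsetTerm, subsetSum, pairProd]
  | succ m ih =>
    intro hyy hAyy b c d e hb hc hd he hbal
    have hbal' : b * c * d * e = A ^ 2 * q ^ m := by
      apply mul_right_cancel₀ hq
      rw [hbal]
      ring
    -- With b and c fixed, d varies along e = L/d, which preserves the balancing condition.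
    set L : ℂ := A ^ 2 * q ^ m / (b * c) with hL
    have hL0 : L ≠ 0 := by positivity
    obtain ⟨w₀, hw₀⟩ : T.Nonempty := card_pos.mp (by omega)
    -- the exceptional values of `d`
    let bad : Set ℂ := {0} ∪ ((⋃ u ∈ T, ⋃ v ∈ T, {d : ℂ | theta p (b * L * (y u * y v) / d) = 0}) ∪
      ⋃ u ∈ T, {d : ℂ | theta p (b * L * (y u / (A * y w₀)) / d) = 0})
    have hbad : bad.Countable := by
      refine (Set.countable_singleton 0).union (Set.Countable.union ?_ ?_)
      · refine Set.Countable.biUnion (Finset.countable_toSet T) fun u _ =>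
          Set.Countable.biUnion (Finset.countable_toSet T) fun v _ => ?_
        have hu := hy u
        have hv := hy v
        exact countable_theta_div_eq_zero hp (by positivity)
      · refine Set.Countable.biUnion (Finset.countable_toSet T) fun u _ => ?_
        have hu := hy u
        have hv := hy w₀
        exact countable_theta_div_eq_zero hp (by positivity)
    have hed : e = L / d := by
      rw [hL]
      field_simp
      linear_combination hbal'
    rw [hed]
    refine eq_of_eqOn_compl_countable (continuousAt_sum_subsetTerm (R := R) hp hA hy T b c hL0 hd)
      (continuousAt_subsetSum (y := y) hp hq hA T hb hc hd) hbad ?_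
    clear hd he hbal hbal' hed
    intro d hdbad
    simp only [bad, Set.mem_union, Set.mem_singleton_iff, Set.mem_iUnion, Set.mem_ofPred_eq, not_or,
      not_exists] at hdbad
    obtain ⟨hd, hd1, hd2⟩ := hdbad
    -- From here d is generic. Now K = be is held fixed together with c and d, and b is the
    -- variable; the balancing condition in the form K c d = A² q^m does not contain b.
    set K : ℂ := b * L / d with hK
    have hK0 : K ≠ 0 := by positivity
    have hKcd : K * c * d = A ^ 2 * q ^ m := by
      rw [hK, hL]
      field_simp
    obtain ⟨G₀, G₁, H₀, H₁, hG⟩ := theta_pair_rank_two hp hK0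
    have hF := Submodule.sub_mem _ (sum_subsetTerm_mem_forms (R := R) (q := q) hp hA hy hK0 hG T c d)
      (subsetSum_mem_forms (y := y) hp hq hA hG T hc hd (by rw [hm, hKcd]; ring))
    -- the interpolation points
    let β : Option T → ℂˣ := fun o => o.elim (Units.mk0 (A * y w₀) (mul_ne_zero hA (hy w₀)))
      fun u => Units.mk0 (y u)⁻¹ (inv_ne_zero (hy u))
    have hcard : Fintype.card (Option T) = #T + 1 := by simp
    have hns : ∀ u : T, G₀ (A * y w₀) * G₁ (y u)⁻¹ ≠ G₁ (A * y w₀) * G₀ (y u)⁻¹ := by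
      intro u
      refine forms_independent hp hG (mul_ne_zero hA (hy w₀)) (inv_ne_zero (hy u)) ?_ ?_
      · rw [div_inv_eq_mul, mul_assoc]
        exact hAyy w₀ hw₀ u u.2
      · have := hd2 u u.2
        convert this using 2
        have := hy u
        have := hy w₀
        rw [hK]
        field_simp
    have hss : ∀ u v : T, u ≠ v → G₀ (y u)⁻¹ * G₁ (y v)⁻¹ ≠ G₁ (y u)⁻¹ * G₀ (y v)⁻¹ := by
      intro u v huv
      refine forms_independent hp hG (inv_ne_zero (hy u)) (inv_ne_zero (hy v)) ?_ ?_
      · rw [inv_div_inv]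
        exact hyy v v.2 u u.2 (fun h => huv (Subtype.ext h.symm))
      · have := hd1 u u.2 v v.2
        convert this using 2
        have := hy u
        have := hy v
        rw [hK]
        field_simp
    have hβ : ∀ i j, i ≠ j → G₀ (β i) * G₁ (β j) ≠ G₁ (β i) * G₀ (β j) := by
      rintro (_ | u) (_ | v) hij
      · exact absurd rfl hij
      · exact hns v
      · intro h
        refine hns u ?_
        simp only [β, Option.elim, Units.val_mk0] at h
        linear_combination -h
      · exact hss u v fun h => hij (by rw [h])
    have hzero : ∀ i, ((fun b : ℂˣ => ∑ S ∈ T.powerset, subsetTerm R p A q y T b c d (K / b) S) -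
        fun b : ℂˣ => subsetSum p A q y T b c d) (β i) = 0 := by
      -- The parameters b'/q and K/b' have product K/q, which is the balancing condition for one
      -- element less.
      have hstep : ∀ w ∈ T, ∀ b' : ℂ, b' ≠ 0 →
          ∑ S ∈ (T.erase w).powerset, subsetTerm R p A q y (T.erase w) (b' / q) c d (K / b') S =
            subsetSum p A q y (T.erase w) (b' / q) c d := by
        intro w hw b' hb'
        have hcw : #(T.erase w) = m := by rw [card_erase_of_mem hw, hm, Nat.add_sub_cancel]
        refine ih (T.erase w) hcw (fun u hu v hv => hyy u (mem_of_mem_erase hu) v (mem_of_mem_erase hv))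
          (fun u hu v hv => hAyy u (mem_of_mem_erase hu) v (mem_of_mem_erase hv))
          (b' / q) c d (K / b') (div_ne_zero hb' hq) hc hd (div_ne_zero hK0 hb') ?_
        rw [← hKcd]
        field_simp
      rintro (_ | ⟨u, hu⟩)
      · have hb' : A * y w₀ ≠ 0 := mul_ne_zero hA (hy w₀)
        have hyw := hy w₀
        have hcw : #(T.erase w₀) = m := by rw [card_erase_of_mem hw₀, hm, Nat.add_sub_cancel]
        refine sub_eq_zero.mpr ?_
        have := sum_subsetTerm_insert_right (R := R) (e := K / (A * y w₀)) hp hq hA hy hR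
          (notMem_erase w₀ T) (by rwa [insert_erase hw₀]) (by rwa [insert_erase hw₀]) hc hd rfl
          (by rw [hcw, ← hKcd]; field_simp) (hstep w₀ hw₀ _ hb')
        rwa [insert_erase hw₀] at this
      · have hu0 := hy u
        have hb' : (y u)⁻¹ ≠ 0 := inv_ne_zero (hy u)
        have hcw : #(T.erase u) = m := by rw [card_erase_of_mem hu, hm, Nat.add_sub_cancel]
        refine sub_eq_zero.mpr ?_
        have := sum_subsetTerm_insert_left (R := R) (b := (y u)⁻¹) (e := K / (y u)⁻¹) hp hq hA hR
          (notMem_erase u T) (by rwa [insert_erase hu]) (by rwa [insert_erase hu]) hc hd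
          (div_ne_zero hK0 hb') (inv_mul_cancel₀ hu0)
          (by rw [hcw, ← hKcd]; field_simp) (hstep u hu _ hb')
        rwa [insert_erase hu] at this
    have hfin := eq_zero_of_mem_forms hF hcard β hβ hzero (Units.mk0 b hb)
    have hKb : K / b = L / d := by
      rw [hK]
      field_simp
    rw [← hKb]
    exact sub_eq_zero.mp hfin

end SubsetSum

/-! ### Theta shifted factorials -/

lemma thetaFac_natCast (p q z : ℂ) (m : ℕ) :
    thetaFac p q z (m : ℤ) = ∏ i ∈ range m, theta p (z * q ^ i) := rfl

lemma thetaFac_mul_prod_Ico (p q z : ℂ) {m n : ℕ} (h : m ≤ n) :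
    thetaFac p q z (m : ℤ) * ∏ i ∈ Ico m n, theta p (z * q ^ i) = thetaFac p q z (n : ℤ) := by
  rw [thetaFac_natCast, thetaFac_natCast, prod_range_mul_prod_Ico _ h]

lemma thetaFac_succ (p q z : ℂ) (m : ℕ) :
    thetaFac p q z ((m + 1 : ℕ) : ℤ) = thetaFac p q z (m : ℤ) * theta p (z * q ^ m) := by
  rw [thetaFac_natCast, thetaFac_natCast, prod_range_succ]

lemma thetaFac_succ' (p q z : ℂ) (m : ℕ) :
    thetaFac p q z ((m + 1 : ℕ) : ℤ) = theta p z * thetaFac p q (z * q) (m : ℤ) := by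
  rw [thetaFac_natCast, thetaFac_natCast, prod_range_succ', mul_comm]
  simp [pow_succ', mul_assoc]

lemma thetaFac_ne_zero {p q z : ℂ} (h : ∀ m : ℕ, theta p (z * q ^ m) ≠ 0) (m : ℕ) :
    thetaFac p q z (m : ℤ) ≠ 0 :=
  prod_ne_zero_iff.mpr fun i _ => h i

lemma thetaFac_sub {p q z : ℂ} {m n : ℕ} (h : m ≤ n) :
    thetaFac p q z ((n : ℤ) - m) = ∏ i ∈ Ico m n, theta p (z * q ^ (i - m)) := by
  rw [← Nat.cast_sub h, thetaFac_natCast, prod_Ico_eq_prod_range]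
  simp

/-- For k < 0 the step cancels a factor of a denominator, so this factor must not vanish; for k ≥ 0
nothing is cancelled. -/
lemma thetaFac_add_one {p q : ℂ} (z : ℂ) (k : ℤ)
    (h : k < 0 → theta p (z * q ^ k) ≠ 0) :
    thetaFac p q z (k + 1) = thetaFac p q z k * theta p (z * q ^ k) := by
  obtain ⟨m, rfl⟩ | ⟨m, rfl⟩ : (∃ m : ℕ, k = m) ∨ ∃ m : ℕ, k = Int.negSucc m := by
    rcases k with m | m
    · exact Or.inl ⟨m, rfl⟩
    · exact Or.inr ⟨m, rfl⟩
  · exact thetaFac_succ p q z m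
  · have hm := h (Int.negSucc_lt_zero m)
    have e : z * q ^ Int.negSucc m = z / q ^ (m + 1) := by
      rw [zpow_negSucc, div_eq_mul_inv]
    rw [e] at hm ⊢
    have e2 : thetaFac p q z (Int.negSucc m) =
        (∏ i ∈ range (m + 1), theta p (z / q ^ (i + 1)))⁻¹ := rfl
    rw [e2, prod_range_succ, mul_inv, inv_mul_cancel_right₀ hm]
    rcases m with _ | m
    · simp [thetaFac]
    · rfl

lemma thetaFac_sub_mul_prod_Ico {p q : ℂ} (z : ℂ) {J m n : ℕ} (hmn : m ≤ n)
    (h : ∀ i, m ≤ i → i < J → theta p (z * q ^ ((i : ℤ) - J)) ≠ 0) :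
    thetaFac p q z ((m : ℤ) - J) * ∏ i ∈ Ico m n, theta p (z * q ^ ((i : ℤ) - J)) =
      thetaFac p q z ((n : ℤ) - J) := by
  induction n, hmn using Nat.le_induction with
  | base => simp
  | succ n hmn ih =>
    rw [prod_Ico_succ_top hmn, ← mul_assoc, ih, ← thetaFac_add_one]
    · congr 1
      push_cast
      ring
    · intro hn
      exact h n hmn (by omega)

lemma thetaFac_sub_ne_zero {p q : ℂ} (z : ℂ) {J m : ℕ} (hmJ : m ≤ J)
    (h : ∀ i, m ≤ i → i < J → theta p (z * q ^ ((i : ℤ) - J)) ≠ 0) :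
    thetaFac p q z ((m : ℤ) - J) ≠ 0 := by
  have := thetaFac_sub_mul_prod_Ico z hmJ h
  rw [sub_self] at this
  intro h0
  rw [h0, zero_mul] at this
  simp [thetaFac] at this

/-! ### Strips of lattice points -/

section Strip

variable {n : ℕ}

/-- The points `(r, i)` with `j_r ≤ i < k_r`. -/
def strip (j k : Fin n → ℕ) : Finset (Σ _ : Fin n, ℕ) := univ.sigma fun r => Ico (j r) (k r)

/-- The lexicographic order on the points `(r, i)`. -/
def lexLT (u v : Σ _ : Fin n, ℕ) : Prop := u.1 < v.1 ∨ u.1 = v.1 ∧ u.2 < v.2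

instance : DecidableRel (lexLT (n := n)) := fun u v => by unfold lexLT; infer_instance

lemma isOrientation_lexLT : IsOrientation (lexLT (n := n)) := by
  refine ⟨fun u => by simp [lexLT], ?_⟩
  rintro ⟨r, i⟩ ⟨s, l⟩ h
  simp only [lexLT]
  have h' : r = s → i ≠ l := by
    rintro rfl rfl
    exact h rfl
  rcases lt_trichotomy r s with h1 | rfl | h1
  · simp [h1, h1.not_gt, h1.ne']
  · have := h' rfl
    simp
    omega
  · simp [h1, h1.not_gt, h1.ne']

lemma mem_strip {j k : Fin n → ℕ} {u : Σ _ : Fin n, ℕ} :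
    u ∈ strip j k ↔ j u.1 ≤ u.2 ∧ u.2 < k u.1 := by
  simp [strip]

lemma prod_strip (j k : Fin n → ℕ) (f : (Σ _ : Fin n, ℕ) → ℂ) :
    ∏ u ∈ strip j k, f u = ∏ r, ∏ i ∈ Ico (j r) (k r), f ⟨r, i⟩ :=
  prod_sigma _ _ _

lemma size_le_size {j k : Fin n → ℕ} (h : j ≤ k) : size j ≤ size k :=
  sum_le_sum fun r _ => h r

lemma card_strip {j k : Fin n → ℕ} (h : j ≤ k) : #(strip j k) = size k - size j := by
  have h1 : size k = size j + #(strip j k) := by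
    rw [strip, card_sigma, size, size, ← sum_add_distrib]
    refine sum_congr rfl fun r _ => ?_
    have : j r ≤ k r := h r
    simp
    omega
  omega

lemma strip_sdiff_strip {j k N : Fin n → ℕ} (hjk : j ≤ k) :
    strip j N \ strip j k = strip k N := by
  ext ⟨r, i⟩
  have h1 : j r ≤ k r := hjk r
  simp only [mem_sdiff, mem_strip]
  omega

/-- A subset with nonzero term is closed downwards in each row. It is therefore the strip from j to
k, where k_r is the first i ≥ j_r with (r, i) outside the subset. -/
lemma sum_powerset_strip {j N : Fin n → ℕ} (hjN : j ≤ N) (f : Finset (Σ _ : Fin n, ℕ) → ℂ)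
    (hf : ∀ S ⊆ strip j N, ∀ r i, j r ≤ i → ⟨r, i⟩ ∉ S → ⟨r, i + 1⟩ ∈ S → f S = 0) :
    ∑ S ∈ (strip j N).powerset, f S = ∑ k ∈ Icc j N, f (strip j k) := by
  have hinj : Set.InjOn (fun k => strip j k) (Icc j N : Finset (Fin n → ℕ)) := by
    intro k hk k' hk' h
    have hk := (mem_Icc.mp hk).1
    have hk' := (mem_Icc.mp hk').1
    funext r
    have h1 := hk r
    have h2 := hk' r
    by_contra hne
    rcases Nat.lt_or_gt_of_ne hne with hlt | hlt
    · have : (⟨r, k r⟩ : Σ _ : Fin n, ℕ) ∈ strip j k := by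
        change strip j k = strip j k' at h
        rw [h, mem_strip]
        exact ⟨h1, hlt⟩
      rw [mem_strip] at this
      exact absurd this.2 (lt_irrefl _)
    · have : (⟨r, k' r⟩ : Σ _ : Fin n, ℕ) ∈ strip j k' := by
        change strip j k = strip j k' at h
        rw [← h, mem_strip]
        exact ⟨h2, hlt⟩
      rw [mem_strip] at this
      exact absurd this.2 (lt_irrefl _)
  rw [← sum_image (f := f) hinj]
  symm
  refine sum_subset ?_ ?_
  · intro S hS
    obtain ⟨k, hk, rfl⟩ := mem_image.mp hS
    rw [mem_powerset]
    intro u hu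
    rw [mem_strip] at hu ⊢
    exact ⟨hu.1, hu.2.trans_le ((mem_Icc.mp hk).2 u.1)⟩
  · intro S hS hnot
    rw [mem_powerset] at hS
    by_contra hne
    have hdown : ∀ r i, j r ≤ i → (⟨r, i + 1⟩ : Σ _ : Fin n, ℕ) ∈ S → ⟨r, i⟩ ∈ S := by
      intro r i hi h1
      by_contra h2
      exact hne (hf S hS r i hi h2 h1)
    apply hnot
    have hex : ∀ r, ∃ d, (⟨r, j r + d⟩ : Σ _ : Fin n, ℕ) ∉ S := by
      intro r
      refine ⟨N r, fun h => ?_⟩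
      have := (mem_strip.mp (hS h)).2
      simp only at this
      omega
    classical
    have hmem : ∀ r i, (⟨r, i⟩ : Σ _ : Fin n, ℕ) ∈ S ↔ j r ≤ i ∧ i < j r + Nat.find (hex r) := by
      intro r i
      constructor
      · intro h
        have h1 := (mem_strip.mp (hS h)).1
        simp only at h1
        refine ⟨h1, ?_⟩
        by_contra! hge
        have : ∀ e, (⟨r, j r + Nat.find (hex r) + e⟩ : Σ _ : Fin n, ℕ) ∈ S → False := by
          intro e
          induction e with
          | zero => exact fun h => Nat.find_spec (hex r) h
          | succ e ih => exact fun h => ih (hdown r _ (by omega) h)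
        refine this (i - (j r + Nat.find (hex r))) ?_
        rwa [Nat.add_sub_cancel' hge]
      · rintro ⟨h1, h2⟩
        have := Nat.find_min (hex r) (m := i - j r) (by omega)
        rw [not_not, Nat.add_sub_cancel' h1] at this
        exact this
    refine mem_image.mpr ⟨fun r => j r + Nat.find (hex r), mem_Icc.mpr ⟨fun r => Nat.le_add_right _ _, ?_⟩, ?_⟩
    · intro r
      by_contra! hlt
      have hlt' : N r < j r + Nat.find (hex r) := hlt
      exact absurd (mem_strip.mp (hS ((hmem r (N r)).mpr ⟨hjN r, hlt'⟩))).2 (lt_irrefl _)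
    · ext ⟨r, i⟩
      rw [mem_strip, hmem]

end Strip

/-! ### Telescoping products and products over pairs of indices -/

lemma prod_Ico_div_succ {f : ℕ → ℂ} {m n : ℕ} (h : m ≤ n) (hf : ∀ i, m ≤ i → i ≤ n → f i ≠ 0) :
    ∏ i ∈ Ico m n, f i / f (i + 1) = f m / f n := by
  induction n, h using Nat.le_induction with
  | base => simp [hf m le_rfl le_rfl]
  | succ n hmn ih =>
    rw [prod_Ico_succ_top hmn, ih fun i h1 h2 => hf i h1 (by omega)]
    have h1 := hf n hmn (by omega)
    field_simp

section Products

variable {n : ℕ}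

lemma prodLT_mul (F G : Fin n → Fin n → ℂ) :
    prodLT (fun r s => F r s * G r s) = prodLT F * prodLT G := by
  simp [prodLT, prod_mul_distrib]

lemma prodLT_div (F G : Fin n → Fin n → ℂ) :
    prodLT (fun r s => F r s / G r s) = prodLT F / prodLT G := by
  simp [prodLT, prod_div_distrib]

lemma prodLT_congr {F G : Fin n → Fin n → ℂ} (h : ∀ r s, r < s → F r s = G r s) :
    prodLT F = prodLT G :=
  prod_congr rfl fun r _ => prod_congr rfl fun s hs => h r s (mem_Ioi.mp hs)

lemma prod_prod_eq_prodLT (X : Fin n → Fin n → ℂ) :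
    ∏ r, ∏ s, X r s = prodLT (fun r s => X r s * X s r) * ∏ r, X r r := by
  have h := prod_prod_Ioi_mul_eq_prod_prod_off_diag (fun r s => X s r)
  rw [prodLT, h, ← prod_mul_distrib]
  refine prod_congr rfl fun r _ => ?_
  rw [mul_comm, ← Fintype.prod_eq_mul_prod_compl]

lemma pairProd_strip (j k : Fin n → ℕ) (f : (Σ _ : Fin n, ℕ) → (Σ _ : Fin n, ℕ) → ℂ) :
    pairProd lexLT f (strip j k) =
      prodLT (fun r s => ∏ i ∈ Ico (j r) (k r), ∏ l ∈ Ico (j s) (k s), f ⟨r, i⟩ ⟨s, l⟩)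
        * ∏ r, ∏ i ∈ Ico (j r) (k r), ∏ l ∈ Ico (j r) (k r), if i < l then f ⟨r, i⟩ ⟨r, l⟩ else 1 := by
  have h : pairProd lexLT f (strip j k) = ∏ r, ∏ s, ∏ i ∈ Ico (j r) (k r), ∏ l ∈ Ico (j s) (k s),
      if lexLT ⟨r, i⟩ ⟨s, l⟩ then f ⟨r, i⟩ ⟨s, l⟩ else 1 := by
    rw [pairProd, prod_strip]
    refine prod_congr rfl fun r _ => ?_
    exact (prod_congr rfl fun i _ => prod_strip _ _ _).trans prod_comm
  rw [h, prod_prod_eq_prodLT]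
  congr 1
  · refine prodLT_congr fun r s hrs => ?_
    simp [lexLT, hrs, hrs.not_gt, hrs.ne']
  · simp [lexLT]

end Products

/-! ### The symmetric factors -/

section Symmetric

variable {p q z : ℂ}

/-- The quotients telescope in both directions, so that only the four corners of the rectangle
remain. -/
lemma prod_block (hz : ∀ m : ℕ, theta p (z * q ^ m) ≠ 0) {j₁ k₁ j₂ k₂ : ℕ} (h₁ : j₁ ≤ k₁)
    (h₂ : j₂ ≤ k₂) :
    ∏ i ∈ Ico j₁ k₁, ∏ l ∈ Ico j₂ k₂, theta p (z * q ^ (i + l)) / theta p (z * q ^ (i + l + 1)) =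
      thetaFac p q z ((k₁ + j₂ : ℕ) : ℤ) * thetaFac p q z ((k₂ + j₁ : ℕ) : ℤ)
        / (thetaFac p q z ((j₁ + j₂ : ℕ) : ℤ) * thetaFac p q z ((k₁ + k₂ : ℕ) : ℤ)) := by
  have hH := thetaFac_ne_zero (q := q) hz
  induction k₁, h₁ using Nat.le_induction with
  | base =>
    have h1 := hH (j₁ + j₂)
    have h2 := hH (j₁ + k₂)
    rw [Ico_self, prod_empty, add_comm k₂ j₁]
    field_simp
  | succ k₁ hjk ih =>
    have e := prod_Ico_div_succ (f := fun l => theta p (z * q ^ (k₁ + l))) h₂ fun i _ _ => hz _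
    simp only [← add_assoc] at e
    have h1 := hH (j₁ + j₂)
    have h2 := hH (k₁ + k₂)
    have h3 := hz (k₁ + k₂)
    rw [prod_Ico_succ_top hjk, ih, e, show k₁ + 1 + j₂ = k₁ + j₂ + 1 by ring,
      show k₁ + 1 + k₂ = k₁ + k₂ + 1 by ring, thetaFac_succ, thetaFac_succ]
    field_simp

/-- For fixed i the product over i < l < k telescopes to θ(z q^(2i+1))/θ(z q^(i+k)); the numerators
next to the diagonal do not cancel. -/
lemma prod_triangle (hz : ∀ m : ℕ, theta p (z * q ^ m) ≠ 0) {j k : ℕ} (h : j ≤ k) :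
    ∏ i ∈ Ico j k, ∏ l ∈ Ico j k,
        (if i < l then theta p (z * q ^ (i + l)) / theta p (z * q ^ (i + l + 1)) else 1) =
      thetaFac p q z ((k + j : ℕ) : ℤ) / thetaFac p q z ((2 * k : ℕ) : ℤ)
        * ∏ i ∈ Ico j k, theta p (z * q ^ (2 * i + 1)) := by
  have hH := thetaFac_ne_zero (q := q) hz
  induction k, h using Nat.le_induction with
  | base =>
    have := hH (j + j)
    simp only [Ico_self, prod_empty, two_mul]
    field_simp
  | succ k hjk ih =>
    have e := prod_Ico_div_succ (f := fun l => theta p (z * q ^ (l + k))) hjk fun i _ _ => hz _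
    have e1 : ∏ i ∈ Ico j k, ∏ l ∈ Ico j (k + 1),
        (if i < l then theta p (z * q ^ (i + l)) / theta p (z * q ^ (i + l + 1)) else 1) =
        (∏ i ∈ Ico j k, ∏ l ∈ Ico j k,
        (if i < l then theta p (z * q ^ (i + l)) / theta p (z * q ^ (i + l + 1)) else 1)) *
          (theta p (z * q ^ (j + k)) / theta p (z * q ^ (k + k))) := by
      rw [← e, ← prod_mul_distrib]
      refine prod_congr rfl fun i hi => ?_
      rw [prod_Ico_succ_top hjk, if_pos (mem_Ico.mp hi).2]
      congr 4
      ring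
    have e2 : ∏ l ∈ Ico j (k + 1),
        (if k < l then theta p (z * q ^ (k + l)) / theta p (z * q ^ (k + l + 1)) else 1) = 1 := by
      refine prod_eq_one fun l hl => if_neg ?_
      have := (mem_Ico.mp hl).2
      omega
    have h1 := hH (2 * k)
    have h2 := hz (2 * k)
    have h3 := hz (2 * k + 1)
    rw [prod_Ico_succ_top hjk, e1, e2, ih, prod_Ico_succ_top hjk,
      show 2 * (k + 1) = 2 * k + 1 + 1 by ring, show k + 1 + j = k + j + 1 by ring, thetaFac_succ,
      thetaFac_succ, thetaFac_succ, ← two_mul, add_comm j k]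
    field_simp

lemma thetaFac_two_mul {k N : ℕ} (h : k ≤ N) :
    thetaFac p q (z * q) ((2 * N : ℕ) : ℤ) = thetaFac p q (z * q) ((2 * k : ℕ) : ℤ)
      * ((∏ i ∈ Ico k N, theta p (z * q ^ (2 * i + 1)))
        * ∏ i ∈ Ico k N, theta p (z * q * q ^ (2 * i + 1))) := by
  induction N, h using Nat.le_induction with
  | base => simp
  | succ N hkN ih =>
    rw [show 2 * (N + 1) = 2 * N + 1 + 1 by ring, thetaFac_succ, thetaFac_succ, ih,
      prod_Ico_succ_top hkN, prod_Ico_succ_top hkN, pow_succ' q (2 * N), mul_assoc z q]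
    ring

lemma prod_inv_block (hz : ∀ m : ℕ, theta p (z * q ^ m) ≠ 0) {j₁ k₁ j₂ k₂ : ℕ} (h₁ : j₁ ≤ k₁)
    (h₂ : j₂ ≤ k₂) :
    ∏ i ∈ Ico j₁ k₁, ∏ l ∈ Ico j₂ k₂, theta p (z * q ^ (i + l + 1)) / theta p (z * q ^ (i + l)) =
      (thetaFac p q z ((j₁ + j₂ : ℕ) : ℤ) * thetaFac p q z ((k₁ + k₂ : ℕ) : ℤ))
        / (thetaFac p q z ((k₁ + j₂ : ℕ) : ℤ) * thetaFac p q z ((k₂ + j₁ : ℕ) : ℤ)) := by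
  rw [← inv_div, ← prod_block hz h₁ h₂]
  simp_rw [← prod_inv_distrib, inv_div]

lemma prod_inv_triangle (hz : ∀ m : ℕ, theta p (z * q ^ m) ≠ 0) {j k : ℕ} (h : j ≤ k) :
    ∏ i ∈ Ico j k, ∏ l ∈ Ico j k,
        (if i < l then theta p (z * q ^ (i + l + 1)) / theta p (z * q ^ (i + l)) else 1) =
      thetaFac p q z ((2 * k : ℕ) : ℤ) / thetaFac p q z ((k + j : ℕ) : ℤ)
        * (∏ i ∈ Ico j k, theta p (z * q ^ (2 * i + 1)))⁻¹ := by
  rw [← inv_div (thetaFac p q z ((k + j : ℕ) : ℤ)), ← mul_inv, ← prod_triangle hz h]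
  simp_rw [← prod_inv_distrib]
  refine prod_congr rfl fun i _ => prod_congr rfl fun l _ => ?_
  split_ifs <;> simp

/-- The two blocks have base points z and zq. Splitting (z)_(m+1) at either end, (z)_m θ(z q^m) =
θ(z) (zq)_m with m = k₁ + k₂, produces the very-well-poised factor. -/
lemma block_mul_block (hz : ∀ m : ℕ, theta p (z * q ^ m) ≠ 0) {j₁ k₁ N₁ j₂ k₂ N₂ : ℕ}
    (h₁ : j₁ ≤ k₁) (h₂ : j₂ ≤ k₂) (h₁' : k₁ ≤ N₁) (h₂' : k₂ ≤ N₂) :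
    (∏ i ∈ Ico j₁ k₁, ∏ l ∈ Ico j₂ k₂, theta p (z * q ^ (i + l)) / theta p (z * q ^ (i + l + 1))) *
      (∏ i ∈ Ico k₁ N₁, ∏ l ∈ Ico k₂ N₂,
        theta p (z * q * q ^ (i + l + 1)) / theta p (z * q * q ^ (i + l))) =
    theta p (z * q ^ (k₁ + k₂)) / theta p z * thetaFac p q (z * q) ((N₁ + N₂ : ℕ) : ℤ)
      / (thetaFac p q (z * q) ((N₂ + k₁ : ℕ) : ℤ) * thetaFac p q (z * q) ((N₁ + k₂ : ℕ) : ℤ))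
      * (thetaFac p q z ((k₁ + j₂ : ℕ) : ℤ) * thetaFac p q z ((k₂ + j₁ : ℕ) : ℤ))
      / thetaFac p q z ((j₁ + j₂ : ℕ) : ℤ) := by
  have hz' : ∀ m : ℕ, theta p (z * q * q ^ m) ≠ 0 := fun m => by
    rw [mul_assoc, ← pow_succ']
    exact hz _
  have hH := thetaFac_ne_zero (q := q) hz
  have hH' := thetaFac_ne_zero (q := q) hz'
  have h0 : theta p z ≠ 0 := by simpa using hz 0
  rw [prod_block hz h₁ h₂, prod_inv_block hz' h₁' h₂']
  have e := thetaFac_succ p q z (k₁ + k₂)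
  rw [thetaFac_succ'] at e
  have n1 := hH (k₁ + k₂)
  have n2 := hH (j₁ + j₂)
  have n3 := hH' (N₂ + k₁)
  have n4 := hH' (N₁ + k₂)
  field_simp
  linear_combination (thetaFac p q z ((k₁ + j₂ : ℕ) : ℤ) * thetaFac p q z ((k₂ + j₁ : ℕ) : ℤ)
    * thetaFac p q (z * q) ((N₁ + N₂ : ℕ) : ℤ)) * e

lemma triangle_mul_triangle (hz : ∀ m : ℕ, theta p (z * q ^ m) ≠ 0) {j k N : ℕ}
    (h : j ≤ k) (h' : k ≤ N) :
    (∏ i ∈ Ico j k, ∏ l ∈ Ico j k,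
        if i < l then theta p (z * q ^ (i + l)) / theta p (z * q ^ (i + l + 1)) else 1) *
      (∏ i ∈ Ico k N, ∏ l ∈ Ico k N,
        if i < l then theta p (z * q * q ^ (i + l + 1)) / theta p (z * q * q ^ (i + l)) else 1) =
    theta p (z * q ^ (2 * k)) / theta p z / thetaFac p q (z * q) ((N + k : ℕ) : ℤ)
      * thetaFac p q z ((k + j : ℕ) : ℤ) * ∏ i ∈ Ico j N, theta p (z * q ^ (2 * i + 1)) := by
  have hz' : ∀ m : ℕ, theta p (z * q * q ^ m) ≠ 0 := fun m => by
    rw [mul_assoc, ← pow_succ']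
    exact hz _
  have hH := thetaFac_ne_zero (q := q) hz
  have hH' := thetaFac_ne_zero (q := q) hz'
  have h0 : theta p z ≠ 0 := by simpa using hz 0
  rw [prod_triangle hz h, prod_inv_triangle hz' h', ← prod_Ico_consecutive _ h h',
    thetaFac_two_mul h']
  have e := thetaFac_succ p q z (2 * k)
  rw [thetaFac_succ'] at e
  have n1 := hH (2 * k)
  have n2 := hH' (N + k)
  have n3 : ∏ i ∈ Ico k N, theta p (z * q * q ^ (2 * i + 1)) ≠ 0 :=
    prod_ne_zero_iff.mpr fun i _ => hz' _
  generalize ∏ i ∈ Ico k N, theta p (z * q * q ^ (2 * i + 1)) = P at *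
  field_simp
  linear_combination (thetaFac p q z ((k + j : ℕ) : ℤ)
    * (∏ i ∈ Ico j k, theta p (z * q ^ (2 * i + 1)))
    * ∏ i ∈ Ico k N, theta p (z * q ^ (2 * i + 1))) * e

end Symmetric

section Factors

variable {n : ℕ} {p q : ℂ} {x : Fin n → ℂ}

/-- The point of the geometric progression with initial value `x_r` that is attached to `(r, i)`. -/
noncomputable def stripVar (q : ℂ) (x : Fin n → ℂ) (u : Σ _ : Fin n, ℕ) : ℂ := x u.1 * q ^ u.2

lemma stripVar_ne_zero (hq : q ≠ 0) (hx : ∀ r, x r ≠ 0) (u : Σ _ : Fin n, ℕ) :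
    stripVar q x u ≠ 0 :=
  mul_ne_zero (hx _) (pow_ne_zero _ hq)

lemma prod_prod_comm_strip (j k j' k' : Fin n → ℕ)
    (f : (Σ _ : Fin n, ℕ) → (Σ _ : Fin n, ℕ) → ℂ) :
    ∏ u ∈ strip j k, ∏ v ∈ strip j' k', f u v =
      ∏ r, ∏ s, ∏ l ∈ Ico (j' s) (k' s), ∏ i ∈ Ico (j r) (k r), f ⟨r, i⟩ ⟨s, l⟩ := by
  rw [prod_strip]
  refine prod_congr rfl fun r _ => ?_
  rw [prod_congr rfl fun i _ => prod_strip _ _ _, prod_comm]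
  exact prod_congr rfl fun s _ => prod_comm

/-- Rows r < s contribute blocks and each single row a triangle. The last product runs over the
whole strip from j to N, hence is constant in k; it later cancels against the same product in
`subsetSum`. -/
lemma pairProd_mul_pairProd {c : ℂ} (hq : q ≠ 0)
    (hc : ∀ r s, ∀ m : ℕ, theta p (c * x r * x s * q ^ m) ≠ 0) {j k N : Fin n → ℕ}
    (hjk : j ≤ k) (hkN : k ≤ N) :
    pairProd lexLT (fun u v => theta p (c * q * (stripVar q x u * stripVar q x v) / q)
        / theta p (c * q * (stripVar q x u * stripVar q x v))) (strip j k)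
      * pairProd lexLT (fun u v => theta p (c * q * (stripVar q x u * stripVar q x v) * q)
        / theta p (c * q * (stripVar q x u * stripVar q x v))) (strip k N) =
    prodLT (fun r s => theta p (c * x r * x s * q ^ (k r + k s)) / theta p (c * x r * x s))
      * (∏ r, theta p (c * x r * x r * q ^ (2 * k r)) / theta p (c * x r * x r))
      * (prodLT (fun r s => thetaFac p q (c * x r * x s * q) ((N r + N s : ℕ) : ℤ))
        / ∏ r, ∏ s, thetaFac p q (c * x r * x s * q) ((N s + k r : ℕ) : ℤ))
      * ((∏ r, ∏ s, thetaFac p q (c * x r * x s) ((k r + j s : ℕ) : ℤ))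
        / prodLT (fun r s => thetaFac p q (c * x r * x s) ((j r + j s : ℕ) : ℤ)))
      * ∏ u ∈ strip j N, theta p (c * q * stripVar q x u ^ 2) := by
  have e1 : ∀ r s i l, theta p (c * q * (stripVar q x ⟨r, i⟩ * stripVar q x ⟨s, l⟩) / q)
        / theta p (c * q * (stripVar q x ⟨r, i⟩ * stripVar q x ⟨s, l⟩)) =
      theta p (c * x r * x s * q ^ (i + l)) / theta p (c * x r * x s * q ^ (i + l + 1)) := by
    intro r s i l
    simp only [stripVar]
    congr 2
    · field_simp
      ring
    · ring
  have e2 : ∀ r s i l, theta p (c * q * (stripVar q x ⟨r, i⟩ * stripVar q x ⟨s, l⟩) * q)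
        / theta p (c * q * (stripVar q x ⟨r, i⟩ * stripVar q x ⟨s, l⟩)) =
      theta p (c * x r * x s * q * q ^ (i + l + 1)) / theta p (c * x r * x s * q * q ^ (i + l)) := by
    intro r s i l
    simp only [stripVar]
    congr 2 <;> ring
  have e3 : ∏ u ∈ strip j N, theta p (c * q * stripVar q x u ^ 2) =
      ∏ r, ∏ i ∈ Ico (j r) (N r), theta p (c * x r * x r * q ^ (2 * i + 1)) := by
    rw [prod_strip]
    refine prod_congr rfl fun r _ => prod_congr rfl fun i _ => ?_
    simp only [stripVar]
    congr 1
    ring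
  rw [pairProd_strip, pairProd_strip, e3]
  simp_rw [e1, e2]
  rw [mul_mul_mul_comm, ← prodLT_mul, ← prod_mul_distrib,
    prodLT_congr fun r s _ => block_mul_block (hc r s) (hjk r) (hjk s) (hkN r) (hkN s),
    prod_congr rfl fun r _ => triangle_mul_triangle (hc r r) (hjk r) (hkN r),
    prod_prod_eq_prodLT (fun r s => thetaFac p q (c * x r * x s * q) ((N s + k r : ℕ) : ℤ)),
    prod_prod_eq_prodLT (fun r s => thetaFac p q (c * x r * x s) ((k r + j s : ℕ) : ℤ)),
    prodLT_div, prodLT_mul, prodLT_div, prodLT_mul, prod_mul_distrib, prod_mul_distrib,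
    prod_div_distrib]
  have e4 : prodLT (fun r s => thetaFac p q (c * x r * x s * q) ((N s + k r : ℕ) : ℤ)
        * thetaFac p q (c * x s * x r * q) ((N r + k s : ℕ) : ℤ)) =
      prodLT (fun r s => thetaFac p q (c * x r * x s * q) ((N s + k r : ℕ) : ℤ)
        * thetaFac p q (c * x r * x s * q) ((N r + k s : ℕ) : ℤ)) :=
    prodLT_congr fun r s _ => by rw [mul_right_comm c (x s)]
  have e5 : prodLT (fun r s => thetaFac p q (c * x r * x s) ((k r + j s : ℕ) : ℤ)
        * thetaFac p q (c * x s * x r) ((k s + j r : ℕ) : ℤ)) =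
      prodLT (fun r s => thetaFac p q (c * x r * x s) ((k r + j s : ℕ) : ℤ)
        * thetaFac p q (c * x r * x s) ((k s + j r : ℕ) : ℤ)) :=
    prodLT_congr fun r s _ => by rw [mul_right_comm c (x s)]
  rw [e4, e5]
  simp only [div_eq_mul_inv, mul_inv]
  ring

/-! ### The antisymmetric factors -/

lemma theta_strip_ne_zero (hq : q ≠ 0) (hx : ∀ r, x r ≠ 0)
    (hqq : ∀ m : ℕ, theta p (q ^ (m + 1)) ≠ 0)
    (hxx : ∀ r s, r ≠ s → ∀ m : ℤ, theta p (q ^ m * (x r / x s)) ≠ 0)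
    {r s : Fin n} {l i : ℕ} (h : r = s → i ≤ l) :
    theta p (x s * q ^ (l + 1) / (x r * q ^ i)) ≠ 0 := by
  by_cases hrs : r = s
  · subst hrs
    have hi := h rfl
    convert hqq (l - i) using 2
    have := hx r
    rw [div_eq_iff (by positivity), show l + 1 = (l - i + 1) + i by omega, pow_add]
    ring
  · convert hxx s r (Ne.symm hrs) ((l + 1 : ℕ) - (i : ℕ)) using 2
    have := hx r
    rw [zpow_sub₀ hq, zpow_natCast, zpow_natCast]
    field_simp

lemma thetaFac_strip (hq : q ≠ 0) (r s : Fin n) (α : ℕ) {m M : ℕ} (h : m ≤ M) :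
    thetaFac p q (q ^ (1 + (m : ℤ) - α) * (x s / x r)) ((M : ℤ) - m) =
      ∏ l ∈ Ico m M, theta p (x s * q ^ (l + 1) / (x r * q ^ α)) := by
  rw [thetaFac_sub h]
  refine prod_congr rfl fun l hl => ?_
  congr 1
  have hl := (mem_Ico.mp hl).1
  rw [zpow_sub₀ hq, zpow_add₀ hq, zpow_one, zpow_natCast, zpow_natCast,
    show l + 1 = (l - m) + m + 1 by omega, pow_add, pow_add]
  field_simp

lemma thetaFac_strip_ne_zero (hq : q ≠ 0) (hx : ∀ r, x r ≠ 0)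
    (hqq : ∀ m : ℕ, theta p (q ^ (m + 1)) ≠ 0)
    (hxx : ∀ r s, r ≠ s → ∀ m : ℤ, theta p (q ^ m * (x r / x s)) ≠ 0)
    {j k : Fin n → ℕ} (hjk : j ≤ k) :
    ∏ r, ∏ s, thetaFac p q (q ^ (1 + (j r : ℤ) - j s) * (x r / x s)) ((k r : ℤ) - j r) ≠ 0 := by
  refine prod_ne_zero_iff.mpr fun r _ => prod_ne_zero_iff.mpr fun s _ => ?_
  rw [thetaFac_strip hq s r _ (hjk r)]
  refine prod_ne_zero_iff.mpr fun l hl => theta_strip_ne_zero hq hx hqq hxx ?_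
  rintro rfl
  exact (mem_Ico.mp hl).1

/-- For fixed (s, l) the product over i telescopes between j_r and k_r. Inverting the two remaining
thetas gives the power of q, and the product over l then gives shifted factorials. -/
lemma prod_theta_ratio (hp : ‖p‖ < 1) (hq : q ≠ 0) (hx : ∀ r, x r ≠ 0)
    (hqq : ∀ m : ℕ, theta p (q ^ (m + 1)) ≠ 0)
    (hxx : ∀ r s, r ≠ s → ∀ m : ℤ, theta p (q ^ m * (x r / x s)) ≠ 0)
    {j k N : Fin n → ℕ} (hjk : j ≤ k) (hkN : k ≤ N) :
    (∏ u ∈ strip j k, ∏ v ∈ strip k N, theta p (stripVar q x u / (q * stripVar q x v))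
        / theta p (stripVar q x u / stripVar q x v))
      * ((∏ r, ∏ s, thetaFac p q (q ^ (1 + (k r : ℤ) - k s) * (x r / x s)) ((N r : ℤ) - k r))
        * ∏ r, ∏ s, thetaFac p q (q ^ (1 + (j r : ℤ) - j s) * (x r / x s)) ((k r : ℤ) - j r)) =
    (q ^ size j / q ^ size k) ^ (size N - size k)
      * ∏ r, ∏ s, thetaFac p q (q ^ (1 + (j r : ℤ) - j s) * (x r / x s)) ((N r : ℤ) - j r) := by
  have hmon : (q ^ size j / q ^ size k) ^ (size N - size k) =
      ∏ r, ∏ s, (q ^ j r / q ^ k r) ^ (N s - k s) := by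
    have : size N - size k = ∑ s, (N s - k s) := by
      have h1 : size N = size k + ∑ s, (N s - k s) := by
        rw [size, size, ← sum_add_distrib]
        refine sum_congr rfl fun s _ => ?_
        have : k s ≤ N s := hkN s
        omega
      omega
    simp_rw [prod_pow_eq_pow_sum]
    rw [this, prod_pow, prod_div_distrib, prod_pow_eq_pow_sum, prod_pow_eq_pow_sum]
    rfl
  rw [hmon, prod_prod_comm_strip, prod_comm (s := univ) (t := univ) (f := fun r s =>
      thetaFac p q (q ^ (1 + (k r : ℤ) - k s) * (x r / x s)) ((N r : ℤ) - k r)),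
    prod_comm (s := univ) (t := univ) (f := fun r s =>
      thetaFac p q (q ^ (1 + (j r : ℤ) - j s) * (x r / x s)) ((k r : ℤ) - j r)),
    prod_comm (s := univ) (t := univ) (f := fun r s =>
      thetaFac p q (q ^ (1 + (j r : ℤ) - j s) * (x r / x s)) ((N r : ℤ) - j r))]
  simp_rw [← prod_mul_distrib]
  refine prod_congr rfl fun r _ => prod_congr rfl fun s _ => ?_
  rw [thetaFac_strip hq r s _ (hkN s), thetaFac_strip hq r s _ (hjk s),
    thetaFac_strip hq r s _ ((hjk s).trans (hkN s)),
    ← prod_Ico_consecutive _ (hjk s) (hkN s), ← Nat.card_Ico, ← prod_const]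
  have key : ∏ l ∈ Ico (k s) (N s), ∏ i ∈ Ico (j r) (k r),
        theta p (stripVar q x ⟨r, i⟩ / (q * stripVar q x ⟨s, l⟩))
          / theta p (stripVar q x ⟨r, i⟩ / stripVar q x ⟨s, l⟩) =
      ∏ l ∈ Ico (k s) (N s), (q ^ j r / q ^ k r) * (theta p (x s * q ^ (l + 1) / (x r * q ^ j r))
        / theta p (x s * q ^ (l + 1) / (x r * q ^ k r))) := by
    refine prod_congr rfl fun l hl => ?_
    have hl := (mem_Ico.mp hl).1
    have hxr := hx r
    have hxs := hx s
    have hinv : ∀ i, theta p (x r * q ^ i / (x s * q ^ (l + 1))) =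
        -(x r * q ^ i / (x s * q ^ (l + 1))) * theta p (x s * q ^ (l + 1) / (x r * q ^ i)) :=
      fun i => theta_eq_neg_mul hp (by positivity) (by field_simp)
    have hne : ∀ i, (r = s → i ≤ l) → theta p (x r * q ^ i / (x s * q ^ (l + 1))) ≠ 0 := by
      intro i hi
      rw [hinv]
      exact mul_ne_zero (neg_ne_zero.mpr (by positivity)) (theta_strip_ne_zero hq hx hqq hxx hi)
    have hjk' : j r ≤ k r := hjk r
    have hkl : r = s → k r ≤ l := by
      rintro rfl
      exact hl
    have e := prod_Ico_div_succ (f := fun i => theta p (x r * q ^ i / (x s * q ^ (l + 1)))) hjk'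
      fun i _ h2 => hne i fun h => h2.trans (hkl h)
    have e' : ∏ i ∈ Ico (j r) (k r), theta p (stripVar q x ⟨r, i⟩ / (q * stripVar q x ⟨s, l⟩))
          / theta p (stripVar q x ⟨r, i⟩ / stripVar q x ⟨s, l⟩) =
        ∏ i ∈ Ico (j r) (k r), theta p (x r * q ^ i / (x s * q ^ (l + 1)))
          / theta p (x r * q ^ (i + 1) / (x s * q ^ (l + 1))) := by
      refine prod_congr rfl fun i _ => ?_
      simp only [stripVar]
      congr 2
      · rw [pow_succ]
        field_simp
      · rw [pow_succ, pow_succ]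
        field_simp
    have n1 := theta_strip_ne_zero hq hx hqq hxx (fun h => hjk'.trans (hkl h) : r = s → j r ≤ l)
    have n2 := theta_strip_ne_zero hq hx hqq hxx hkl
    rw [e', e, hinv, hinv]
    field_simp
  rw [key, prod_mul_distrib,
    prod_div_distrib (f := fun l => theta p (x s * q ^ (l + 1) / (x r * q ^ j r)))]
  have n1 : ∏ l ∈ Ico (k s) (N s), theta p (x s * q ^ (l + 1) / (x r * q ^ k r)) ≠ 0 := by
    refine prod_ne_zero_iff.mpr fun l hl => theta_strip_ne_zero hq hx hqq hxx ?_
    rintro rfl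
    exact (mem_Ico.mp hl).1
  generalize ∏ l ∈ Ico (k s) (N s), theta p (x s * q ^ (l + 1) / (x r * q ^ k r)) = X at n1 ⊢
  field_simp

end Factors

/-! ### Single products and monomials as products over strips -/

section Factors

variable {n : ℕ} {p q : ℂ} {x : Fin n → ℂ}

/-- The numerator is extended from j to k and the denominator is completed from k to N. The
dependence on k thus becomes a product over S = `strip j k` and one over its complement `strip k N`.
-/
lemma prod_thetaFac_div {w w' : ℂ} (hw' : ∀ r, ∀ m : ℕ, theta p (w' * x r * q ^ m) ≠ 0)
    {j k N : Fin n → ℕ} (hjk : j ≤ k) (hkN : k ≤ N) :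
    ∏ r, thetaFac p q (w * x r) (k r) / thetaFac p q (w' * x r) (k r) =
      (∏ r, thetaFac p q (w * x r) (j r) / thetaFac p q (w' * x r) (N r)) *
        ((∏ u ∈ strip j k, theta p (w * stripVar q x u)) *
          ∏ u ∈ strip k N, theta p (w' * stripVar q x u)) := by
  rw [prod_strip, prod_strip, ← prod_mul_distrib, ← prod_mul_distrib]
  refine prod_congr rfl fun r _ => ?_
  have h1 := thetaFac_ne_zero (q := q) (hw' r) (k r)
  have h2 := thetaFac_ne_zero (q := q) (hw' r) (N r)
  simp only [stripVar, ← mul_assoc]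
  rw [← thetaFac_mul_prod_Ico p q (w * x r) (hjk r)]
  have e := thetaFac_mul_prod_Ico p q (w' * x r) (hkN r)
  rw [← e] at h2 ⊢
  have h3 := right_ne_zero_of_mul h2
  generalize ∏ i ∈ Ico (k r) (N r), theta p (w' * x r * q ^ i) = P at h3 ⊢
  generalize thetaFac p q (w' * x r) (k r) = D at h1 ⊢
  field_simp

/-- The factorial of length N_r - k_r, read backwards and with theta inverted, is a product over the
strip from k to N. -/
lemma prod_thetaFac_mul_reflect (hp : ‖p‖ < 1) (hq : q ≠ 0) (hx : ∀ r, x r ≠ 0) {b t : ℂ}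
    (ht : t ≠ 0) {M : ℕ} {j k N : Fin n → ℕ} (hjk : j ≤ k) (hkN : k ≤ N) :
    ∏ r, (thetaFac p q (b * x r) (M + k r)
        * thetaFac p q (q ^ (1 + (M : ℤ) - N r) / (t * x r)) ((N r : ℤ) - k r)) =
      (∏ r, thetaFac p q (b * x r) (M + j r)) *
        ((∏ u ∈ strip j k, theta p (b * q ^ M * stripVar q x u)) *
          ((∏ u ∈ strip k N, -(q ^ M / (t * stripVar q x u))) *
            ∏ u ∈ strip k N, theta p (t * stripVar q x u / q ^ M))) := by
  rw [← prod_mul_distrib (s := strip k N), prod_strip, prod_strip, ← prod_mul_distrib,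
    ← prod_mul_distrib]
  refine prod_congr rfl fun r _ => ?_
  have hk : k r ≤ N r := hkN r
  have hj : j r ≤ k r := hjk r
  have e1 : thetaFac p q (b * x r) (M + k r) = thetaFac p q (b * x r) (M + j r) *
      ∏ i ∈ Ico (j r) (k r), theta p (b * q ^ M * stripVar q x ⟨r, i⟩) := by
    rw [← Nat.cast_add, ← Nat.cast_add, ← thetaFac_mul_prod_Ico p q _ (Nat.add_le_add_left hj M),
      add_comm M, add_comm M, ← prod_Ico_add' (fun i => theta p (b * x r * q ^ i))]
    congr 1
    refine prod_congr rfl fun i _ => ?_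
    simp only [stripVar]
    congr 1
    ring
  have e2 : thetaFac p q (q ^ (1 + (M : ℤ) - N r) / (t * x r)) ((N r : ℤ) - k r) =
      ∏ i ∈ Ico (k r) (N r), -(q ^ M / (t * stripVar q x ⟨r, i⟩)) *
        theta p (t * stripVar q x ⟨r, i⟩ / q ^ M) := by
    rw [← Nat.cast_sub hk, thetaFac_natCast, prod_Ico_eq_prod_range, ← prod_range_reflect]
    refine prod_congr rfl fun i hi => ?_
    have hi := mem_range.mp hi
    have hxr := hx r
    have hy := stripVar_ne_zero hq hx ⟨r, k r + i⟩
    have e3 : q ^ (1 + (M : ℤ) - N r) / (t * x r) * q ^ (N r - k r - 1 - i) =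
        q ^ M / (t * stripVar q x ⟨r, k r + i⟩) := by
      simp only [stripVar]
      rw [zpow_sub₀ hq, zpow_add₀ hq, zpow_one, zpow_natCast, zpow_natCast]
      field_simp
      rw [← pow_succ', ← pow_add]
      congr 1
      omega
    rw [e3]
    exact theta_eq_neg_mul hp (by positivity) (by field_simp)
  rw [e1, e2]
  ring

lemma prod_thetaFac_sub_div (hq : q ≠ 0) {w a : ℂ} {J : ℕ} {j k N : Fin n → ℕ} (hjk : j ≤ k)
    (hkN : k ≤ N) (hjJ : ∀ r, j r ≤ J)
    (hw : ∀ r i, j r ≤ i → i < J → theta p (w * x r * q ^ ((i : ℤ) - J)) ≠ 0)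
    (ha : ∀ r, ∀ m : ℕ, theta p (a * x r * q ^ (m + 1)) ≠ 0) :
    ∏ r, (thetaFac p q (w * x r) ((k r : ℤ) - J)
        / (thetaFac p q (w * x r) ((j r : ℤ) - J) * thetaFac p q (a * x r * q) (k r + J))) =
      (∏ r, thetaFac p q (a * x r * q) (N r + J))⁻¹ *
        ((∏ u ∈ strip j k, theta p (w / q ^ J * stripVar q x u)) *
          ∏ u ∈ strip k N, theta p (a * q ^ (J + 1) * stripVar q x u)) := by
  rw [prod_strip, prod_strip, ← prod_inv_distrib, ← prod_mul_distrib, ← prod_mul_distrib]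
  refine prod_congr rfl fun r _ => ?_
  have hk : k r ≤ N r := hkN r
  have hj : j r ≤ k r := hjk r
  have ha' : ∀ m : ℕ, theta p (a * x r * q * q ^ m) ≠ 0 := fun m => by
    convert ha r m using 2
    ring
  have h1 := thetaFac_sub_ne_zero (w * x r) (hjJ r) (hw r)
  have e1 : ∏ i ∈ Ico (j r) (k r), theta p (w / q ^ J * stripVar q x ⟨r, i⟩) =
      ∏ i ∈ Ico (j r) (k r), theta p (w * x r * q ^ ((i : ℤ) - J)) := by
    refine prod_congr rfl fun i _ => ?_
    rw [zpow_sub₀ hq, zpow_natCast, zpow_natCast]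
    simp only [stripVar]
    congr 1
    field_simp
  have e2 : thetaFac p q (a * x r * q) (N r + J) = thetaFac p q (a * x r * q) (k r + J) *
      ∏ i ∈ Ico (k r) (N r), theta p (a * q ^ (J + 1) * stripVar q x ⟨r, i⟩) := by
    rw [← Nat.cast_add, ← Nat.cast_add, ← thetaFac_mul_prod_Ico p q _ (Nat.add_le_add_right hk J),
      ← prod_Ico_add' (fun i => theta p (a * x r * q * q ^ i))]
    congr 1
    refine prod_congr rfl fun i _ => ?_
    simp only [stripVar]
    congr 1
    ring
  have h2 : thetaFac p q (a * x r * q) (N r + J) ≠ 0 := by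
    rw [← Nat.cast_add]
    exact thetaFac_ne_zero ha' _
  rw [e2] at h2
  have h3 := left_ne_zero_of_mul h2
  have h4 := right_ne_zero_of_mul h2
  rw [e1, e2, ← thetaFac_sub_mul_prod_Ico (w * x r) hj (hw r)]
  field_simp

/-! ### The monomial factors -/

lemma two_mul_choose_two_add (m : ℕ) : 2 * m.choose 2 + m = m * m := by
  induction m with
  | zero => rfl
  | succ m ih =>
    rw [Nat.choose_succ_succ' m 1, Nat.choose_one_right]
    linarith

/-- Among |k| objects in groups of sizes k_r, a pair lies either in two groups or in one. -/
lemma pairSum_add_sum_choose (k : Fin n → ℕ) :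
    pairSum k + ∑ r, (k r).choose 2 = (size k).choose 2 := by
  have h1 : size k * size k = 2 * pairSum k + ∑ r, k r * k r := by
    have h := sum_sum_Ioi_add_eq_sum_sum_off_diag (fun r s => k r * k s)
    rw [size, sum_mul_sum, pairSum, mul_sum]
    have e : ∑ r, ∑ s, k r * k s = ∑ r, (k r * k r + ∑ s ∈ {r}ᶜ, k s * k r) := by
      refine sum_congr rfl fun r _ => ?_
      rw [Fintype.sum_eq_add_sum_compl r]
      congr 1
      exact sum_congr rfl fun s _ => mul_comm _ _
    rw [e, sum_add_distrib, ← h, add_comm]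
    congr 1
    refine sum_congr rfl fun r _ => ?_
    rw [mul_sum]
    refine sum_congr rfl fun s _ => ?_
    ring
  have h2 := two_mul_choose_two_add (size k)
  have h3 : 2 * ∑ r, (k r).choose 2 + size k = ∑ r, k r * k r := by
    rw [size, mul_sum, ← sum_add_distrib]
    exact sum_congr rfl fun r _ => two_mul_choose_two_add (k r)
  omega

lemma prod_strip_stripVar (q : ℂ) (x : Fin n → ℂ) {j k : Fin n → ℕ} (hjk : j ≤ k) :
    (∏ u ∈ strip j k, stripVar q x u) * ((∏ r, x r ^ j r) * q ^ ∑ r, (j r).choose 2) =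
      (∏ r, x r ^ k r) * q ^ ∑ r, (k r).choose 2 := by
  rw [prod_strip, ← prod_pow_eq_pow_sum, ← prod_pow_eq_pow_sum, ← prod_mul_distrib,
    ← prod_mul_distrib, ← prod_mul_distrib]
  refine prod_congr rfl fun r _ => ?_
  have h : j r ≤ k r := hjk r
  generalize k r = K at h ⊢
  induction K, h using Nat.le_induction with
  | base => simp
  | succ K hK ih =>
    rw [prod_Ico_succ_top hK, mul_right_comm, ih, Nat.choose_succ_succ' K 1, Nat.choose_one_right]
    simp only [stripVar]
    ring

/-- Shows that the monomials in k amount to the sign and the power of q in `subsetTerm`, apart from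
the power of q that `prod_theta_ratio` produces and factors free of k. -/
lemma monomial_eq (hq : q ≠ 0) (hx : ∀ r, x r ≠ 0) {t : ℂ} (ht : t ≠ 0) {j k N : Fin n → ℕ}
    (hjk : j ≤ k) (hkN : k ≤ N) :
    (q / t) ^ size k * (∏ r, (x r ^ k r)⁻¹) * q ^ pairSum k
        * ∏ u ∈ strip k N, -(q ^ size N / (t * stripVar q x u)) =
      (-1) ^ #(strip j k) * (q ^ (#(strip j k)).choose 2)⁻¹
        * (q ^ size j / q ^ size k) ^ (size N - size k)
        * ((q / t) ^ size j * (∏ r, (x r ^ j r)⁻¹) * q ^ pairSum j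
          * ∏ u ∈ strip j N, -(q ^ size N / (t * stripVar q x u))) := by
  have hprod : ∏ u ∈ strip j N, -(q ^ size N / (t * stripVar q x u)) =
      (∏ u ∈ strip k N, -(q ^ size N / (t * stripVar q x u))) *
        ∏ u ∈ strip j k, -(q ^ size N / (t * stripVar q x u)) := by
    rw [← strip_sdiff_strip hjk]
    refine (prod_sdiff fun u hu => ?_).symm
    rw [mem_strip] at hu ⊢
    exact ⟨hu.1, hu.2.trans_le (hkN _)⟩
  have hcard := card_strip hjk
  obtain ⟨d, hd⟩ := Nat.exists_eq_add_of_le (size_le_size hjk)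
  obtain ⟨e, he⟩ := Nat.exists_eq_add_of_le (size_le_size hkN)
  have hcd : #(strip j k) = d := by omega
  have hE : ∏ u ∈ strip j k, -(q ^ size N / (t * stripVar q x u)) =
      (-1) ^ d * (q ^ size N / t) ^ d * (∏ u ∈ strip j k, stripVar q x u)⁻¹ := by
    rw [← hcd, ← prod_const, ← prod_const, ← prod_inv_distrib, ← prod_mul_distrib,
      ← prod_mul_distrib]
    refine prod_congr rfl fun u _ => ?_
    have := stripVar_ne_zero hq hx u
    field_simp
  have hv := prod_strip_stripVar q x hjk
  have hj := pairSum_add_sum_choose j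
  have hk := pairSum_add_sum_choose k
  have nv : ∏ u ∈ strip j k, stripVar q x u ≠ 0 :=
    prod_ne_zero_iff.mpr fun u _ => stripVar_ne_zero hq hx u
  have nk : ∏ r, x r ^ k r ≠ 0 := prod_ne_zero_iff.mpr fun r _ => pow_ne_zero _ (hx r)
  have nj : ∏ r, x r ^ j r ≠ 0 := prod_ne_zero_iff.mpr fun r _ => pow_ne_zero _ (hx r)
  rw [hprod, hE, hcd, he, show size k + e - size k = e by omega, hd, prod_inv_distrib,
    prod_inv_distrib]
  have hsq : ((-1 : ℂ) ^ d) * (-1) ^ d = 1 := by rw [← mul_pow]; simp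
  -- With d = |k| - |j| and e = |N| - |k|, the exponents agree because C(|j|+d, 2) + C(d, 2) + de +
  -- d = C(|j|, 2) + (|j|+d+e)d.
  have hexp : q ^ pairSum k * q ^ (∑ r, (k r).choose 2) * q ^ d.choose 2 * q ^ (d * e) * q ^ d =
      q ^ pairSum j * q ^ (∑ r, (j r).choose 2) * q ^ ((size j + d + e) * d) := by
    simp only [← pow_add]
    congr 1
    rw [hj, hk, hd]
    have c1 := two_mul_choose_two_add (size j + d)
    have c2 := two_mul_choose_two_add (size j)
    have c3 := two_mul_choose_two_add d
    nlinarith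
  generalize ∏ u ∈ strip k N, -(q ^ (size j + d + e) / (t * stripVar q x u)) = Z
  generalize ∏ u ∈ strip j k, stripVar q x u = V at hv nv ⊢
  generalize ∏ r, x r ^ k r = Xk at hv nk ⊢
  generalize ∏ r, x r ^ j r = Xj at hv nj ⊢
  have key : q ^ pairSum k * q ^ d.choose 2 * q ^ (d * e) * q ^ d * Xj * V =
      q ^ pairSum j * q ^ ((size j + d + e) * d) * Xk := by
    apply mul_right_cancel₀ (pow_ne_zero (∑ r, (j r).choose 2) hq)
    linear_combination (q ^ pairSum k * q ^ d.choose 2 * q ^ (d * e) * q ^ d) * hv + Xk * hexp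
  have r1 : (q ^ size j / q ^ (size j + d)) ^ e = (q ^ (d * e))⁻¹ := by
    have h : q ^ size j / q ^ (size j + d) = (q ^ d)⁻¹ := by
      rw [pow_add]
      field_simp
    rw [h, inv_pow, pow_mul]
  have r2 : (q ^ (size j + d + e) / t) ^ d = q ^ ((size j + d + e) * d) / t ^ d := by
    rw [div_pow, ← pow_mul]
  have r3 : (q / t) ^ (size j + d) = (q / t) ^ size j * (q ^ d / t ^ d) := by
    rw [pow_add, div_pow q t d]
  rw [r1, r2, r3]
  have key' : q ^ d * Xk⁻¹ * q ^ pairSum k = (q ^ d.choose 2)⁻¹ * (q ^ (d * e))⁻¹ * Xj⁻¹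
      * q ^ pairSum j * q ^ ((size j + d + e) * d) * V⁻¹ := by
    have n1 : q ^ d.choose 2 ≠ 0 := pow_ne_zero _ hq
    have n2 : q ^ (d * e) ≠ 0 := pow_ne_zero _ hq
    generalize q ^ d.choose 2 = y₁ at key n1 ⊢
    generalize q ^ (d * e) = y₂ at key n2 ⊢
    generalize q ^ ((size j + d + e) * d) = y₃ at key ⊢
    generalize q ^ d = y₄ at key ⊢
    generalize q ^ pairSum k = y₅ at key ⊢
    generalize q ^ pairSum j = y₆ at key ⊢
    field_simp
    linear_combination key
  linear_combination ((q / t) ^ size j * (t ^ d)⁻¹ * Z) * key' - ((q / t) ^ size j * (t ^ d)⁻¹ * Z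
    * ((q ^ d.choose 2)⁻¹ * (q ^ (d * e))⁻¹ * Xj⁻¹ * q ^ pairSum j * q ^ ((size j + d + e) * d)
    * V⁻¹)) * hsq

end Factors

/-! ### The product of the coefficients of β' with the matrix B⁽⁴⁾ -/

section Composition

variable {n : ℕ} {p q a b c ρ₁ ρ₂ : ℂ} {x : Fin n → ℂ}

/-- The coefficient of `β_k(a, bρ₁ρ₂/aq)` in the sum that defines `β'_N(a, b)`. -/
noncomputable def betaWeight (p q ρ₁ ρ₂ : ℂ) (x : Fin n → ℂ) (N k : Fin n → ℕ) (a b : ℂ) : ℂ :=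
  (∏ r, (thetaFac p q (ρ₁ * x r) (k r) * thetaFac p q (ρ₂ * x r) (k r)
          * thetaFac p q (a * q ^ (1 + (size N : ℤ) - N r) / (ρ₁ * ρ₂ * x r)) ((N r : ℤ) - k r)
        / (thetaFac p q (b * ρ₁ * x r / a) (k r) * thetaFac p q (b * ρ₂ * x r / a) (k r))))
    * prodLT (fun r s =>
        theta p (b * ρ₁ * ρ₂ * x r * x s * q ^ (k r + k s) / (a * q))
          / theta p (b * ρ₁ * ρ₂ * x r * x s / (a * q)))
    * (∏ r, (theta p (b * ρ₁ * ρ₂ * x r ^ 2 * q ^ (2 * k r) / (a * q))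
          / theta p (b * ρ₁ * ρ₂ * x r ^ 2 / (a * q))))
    * (prodLT (fun r s => thetaFac p q (b * ρ₁ * ρ₂ * x r * x s / a) (N r + N s))
        * (∏ r, thetaFac p q (b * x r) (size N + k r))
      / ∏ r, ∏ s, (thetaFac p q (b * ρ₁ * ρ₂ * x r * x s / a) (N s + k r)
          * thetaFac p q (q ^ (1 + (k r : ℤ) - k s) * (x r / x s)) ((N r : ℤ) - k r)))
    * (a * q / (ρ₁ * ρ₂)) ^ size k
    * (∏ r, (x r ^ k r)⁻¹)
    * q ^ pairSum k

/-- The coefficient of `α_N(a, bρ₁ρ₂/aq)` in `α'_N(a, b)`. -/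
noncomputable def alphaWeight (p q ρ₁ ρ₂ : ℂ) (x : Fin n → ℂ) (N : Fin n → ℕ) (a : ℂ) : ℂ :=
  (∏ r, (thetaFac p q (ρ₁ * x r) (N r) * thetaFac p q (ρ₂ * x r) (N r)))
    / (thetaFac p q (a * q / ρ₁) (size N) * thetaFac p q (a * q / ρ₂) (size N))
  * (a * q / (ρ₁ * ρ₂)) ^ size N
  * (∏ r, (x r ^ N r)⁻¹)
  * q ^ pairSum N

/-- A regrouping by type of factor. Here ρ₁ is put with bρ₂/a, and ρ₂ with bρ₁/a, since cq/ρ₁ =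
bρ₂/a and cq/ρ₂ = bρ₁/a: this is how they occur in `subsetTerm` with A = cq. -/
lemma betaWeight_mul_B4 (hq : q ≠ 0) (ha : a ≠ 0) (hc : c = b * ρ₁ * ρ₂ / (a * q))
    (N k j : Fin n → ℕ) :
    betaWeight p q ρ₁ ρ₂ x N k a b * B4 p q x k j a c =
      (∏ r, thetaFac p q (ρ₁ * x r) (k r) / thetaFac p q (b * ρ₂ / a * x r) (k r))
      * (∏ r, thetaFac p q (ρ₂ * x r) (k r) / thetaFac p q (b * ρ₁ / a * x r) (k r))
      * (∏ r, (thetaFac p q (b * x r) (size N + k r) *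
          thetaFac p q (q ^ (1 + (size N : ℤ) - N r) / (ρ₁ * ρ₂ / a * x r)) ((N r : ℤ) - k r)))
      * (∏ r, (thetaFac p q (c / a * x r) ((k r : ℤ) - size j)
        / (thetaFac p q (c / a * x r) ((j r : ℤ) - size j)
          * thetaFac p q (a * x r * q) (k r + size j))))
      * (prodLT (fun r s => theta p (c * x r * x s * q ^ (k r + k s)) / theta p (c * x r * x s))
        * (∏ r, theta p (c * x r * x r * q ^ (2 * k r)) / theta p (c * x r * x r))
        * (prodLT (fun r s => thetaFac p q (c * x r * x s * q) ((N r + N s : ℕ) : ℤ))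
          / ∏ r, ∏ s, thetaFac p q (c * x r * x s * q) ((N s + k r : ℕ) : ℤ))
        * ((∏ r, ∏ s, thetaFac p q (c * x r * x s) ((k r + j s : ℕ) : ℤ))
          / prodLT (fun r s => thetaFac p q (c * x r * x s) ((j r + j s : ℕ) : ℤ))))
      * ((∏ r, ∏ s, thetaFac p q (q ^ (1 + (k r : ℤ) - k s) * (x r / x s)) ((N r : ℤ) - k r))
        * ∏ r, ∏ s, thetaFac p q (q ^ (1 + (j r : ℤ) - j s) * (x r / x s)) ((k r : ℤ) - j r))⁻¹
      * ((q / (ρ₁ * ρ₂ / a)) ^ size k * (∏ r, (x r ^ k r)⁻¹) * q ^ pairSum k) := by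
  have e1 : ∀ r s, b * ρ₁ * ρ₂ * x r * x s / (a * q) = c * x r * x s := fun r s => by
    rw [hc]
    ring
  have e2 : ∀ r s m, b * ρ₁ * ρ₂ * x r * x s * q ^ m / (a * q) = c * x r * x s * q ^ m :=
    fun r s m => by
      rw [hc]
      ring
  have e3 : ∀ r, b * ρ₁ * ρ₂ * x r ^ 2 / (a * q) = c * x r * x r := fun r => by
    rw [hc]
    ring
  have e4 : ∀ r m, b * ρ₁ * ρ₂ * x r ^ 2 * q ^ m / (a * q) = c * x r * x r * q ^ m := fun r m => by
    rw [hc]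
    ring
  have e5 : ∀ r s, b * ρ₁ * ρ₂ * x r * x s / a = c * x r * x s * q := fun r s => by
    rw [hc]
    field_simp
  have e6 : ∀ r, b * ρ₁ * x r / a = b * ρ₁ / a * x r := fun r => by ring
  have e7 : ∀ r, b * ρ₂ * x r / a = b * ρ₂ / a * x r := fun r => by ring
  have e8 : ∀ (m : ℤ) r, a * q ^ m / (ρ₁ * ρ₂ * x r) = q ^ m / (ρ₁ * ρ₂ / a * x r) := fun m r => by
    field_simp
  have e9 : ∀ r, c * x r / a = c / a * x r := fun r => by ring
  have e10 : a * q / (ρ₁ * ρ₂) = q / (ρ₁ * ρ₂ / a) := by field_simp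
  simp only [betaWeight, B4, e1, e2, e3, e4, e5, e6, e7, e8, e9, e10, prod_mul_distrib,
    prod_div_distrib, Nat.cast_add]
  simp only [div_eq_mul_inv, mul_inv]
  ring

/-- Neighbours in a row satisfy y_(r,i+1) = q y_(r,i), so the cross factor contains θ(1) = 0. -/
lemma subsetTerm_eq_zero (hp : ‖p‖ < 1) (hq : q ≠ 0) (hx : ∀ r, x r ≠ 0) (A d e : ℂ)
    {j N : Fin n → ℕ} {S : Finset (Σ _ : Fin n, ℕ)} (hS : S ⊆ strip j N) {r : Fin n} {i : ℕ}
    (hi : j r ≤ i) (h : ⟨r, i⟩ ∉ S) (h' : ⟨r, i + 1⟩ ∈ S) :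
    subsetTerm lexLT p A q (stripVar q x) (strip j N) b c d e S = 0 := by
  have hmem : (⟨r, i⟩ : Σ _ : Fin n, ℕ) ∈ strip j N \ S := by
    refine mem_sdiff.mpr ⟨mem_strip.mpr ⟨hi, ?_⟩, h⟩
    have := (mem_strip.mp (hS h')).2
    simp only at this ⊢
    omega
  have h0 : theta p (stripVar q x ⟨r, i + 1⟩ / (q * stripVar q x ⟨r, i⟩)) = 0 := by
    rw [← theta_one hp]
    congr 1
    have := hx r
    simp only [stripVar]
    field_simp
    rw [pow_succ']
  unfold subsetTerm
  rw [prod_eq_zero (f := fun u => ∏ v ∈ strip j N \ S, theta p (stripVar q x u / (q * stripVar q x v))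
    / theta p (stripVar q x u / stripVar q x v)) h' (prod_eq_zero hmem (by rw [h0, zero_div]))]
  ring

/-- The summand in the composition of the two matrices is a multiple of the summand in the sum over
the subsets of a strip. -/
lemma betaWeight_mul_B4_eq_subsetTerm (hp : ‖p‖ < 1) (hq : q ≠ 0) (ha : a ≠ 0) (hb : b ≠ 0)
    (hρ₁ : ρ₁ ≠ 0) (hρ₂ : ρ₂ ≠ 0) (hx : ∀ r, x r ≠ 0) (hc : c = b * ρ₁ * ρ₂ / (a * q))
    (hqq : ∀ m : ℕ, theta p (q ^ (m + 1)) ≠ 0)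
    (hxx : ∀ r s, r ≠ s → ∀ m : ℤ, theta p (q ^ m * (x r / x s)) ≠ 0)
    (hax : ∀ r, ∀ m : ℕ, theta p (a * x r * q ^ (m + 1)) ≠ 0)
    (hbρ₁ : ∀ r, ∀ m : ℕ, theta p (b * ρ₁ / a * x r * q ^ m) ≠ 0)
    (hbρ₂ : ∀ r, ∀ m : ℕ, theta p (b * ρ₂ / a * x r * q ^ m) ≠ 0)
    (hcxx : ∀ r s, ∀ m : ℕ, theta p (c * x r * x s * q ^ m) ≠ 0) {j k N : Fin n → ℕ}
    (hcx : ∀ r i, j r ≤ i → i < size j → theta p (c / a * x r * q ^ ((i : ℤ) - size j)) ≠ 0)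
    (hjk : j ≤ k) (hkN : k ≤ N) :
    betaWeight p q ρ₁ ρ₂ x N k a b * B4 p q x k j a c =
      (∏ r, thetaFac p q (ρ₁ * x r) (j r) / thetaFac p q (b * ρ₂ / a * x r) (N r))
      * (∏ r, thetaFac p q (ρ₂ * x r) (j r) / thetaFac p q (b * ρ₁ / a * x r) (N r))
      * (∏ r, thetaFac p q (b * x r) (size N + j r))
      * (∏ r, thetaFac p q (a * x r * q) (N r + size j))⁻¹
      * (∏ u ∈ strip j N, theta p (c * q * stripVar q x u ^ 2))⁻¹
      * (∏ r, ∏ s, thetaFac p q (q ^ (1 + (j r : ℤ) - j s) * (x r / x s)) ((N r : ℤ) - j r))⁻¹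
      * ((q / (ρ₁ * ρ₂ / a)) ^ size j * (∏ r, (x r ^ j r)⁻¹) * q ^ pairSum j
        * ∏ u ∈ strip j N, -(q ^ size N / (ρ₁ * ρ₂ / a * stripVar q x u)))
      * subsetTerm lexLT p (c * q) q (stripVar q x) (strip j N) (c / a / q ^ size j) ρ₁ ρ₂
        (b * q ^ size N) (strip j k) := by
  have hc0 : c ≠ 0 := by
    rw [hc]
    positivity
  have hy := stripVar_ne_zero hq hx
  have ht : ρ₁ * ρ₂ / a ≠ 0 := by positivity
  have e1 : ∀ u, c * q * stripVar q x u / ρ₁ = b * ρ₂ / a * stripVar q x u := fun u => by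
    rw [hc]
    field_simp
  have e2 : ∀ u, c * q * stripVar q x u / ρ₂ = b * ρ₁ / a * stripVar q x u := fun u => by
    rw [hc]
    field_simp
  have e3 : ∀ u, c * q * stripVar q x u / (b * q ^ size N) =
      ρ₁ * ρ₂ / a * stripVar q x u / q ^ size N := fun u => by
    rw [hc]
    field_simp
  have e4 : ∀ u, c * q * stripVar q x u / (c / a / q ^ size j) =
      a * q ^ (size j + 1) * stripVar q x u := fun u => by
    rw [pow_succ]
    field_simp
  have hsize : ∀ r, j r ≤ size j := fun r => single_le_sum (fun _ _ => Nat.zero_le _) (mem_univ r)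
  have hΘ : ∏ u ∈ strip j N, theta p (c * q * stripVar q x u ^ 2) ≠ 0 := by
    refine prod_ne_zero_iff.mpr fun u _ => ?_
    convert hcxx u.1 u.1 (2 * u.2 + 1) using 2
    simp only [stripVar]
    ring
  have hQ := mul_ne_zero (thetaFac_strip_ne_zero hq hx hqq hxx hkN)
    (thetaFac_strip_ne_zero hq hx hqq hxx hjk)
  have hQ0 := thetaFac_strip_ne_zero hq hx hqq hxx (hjk.trans hkN)
  have hsym := pairProd_mul_pairProd hq hcxx hjk hkN
  have hanti := prod_theta_ratio hp hq hx hqq hxx hjk hkN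
  have hmono := monomial_eq hq hx ht hjk hkN
  have hM : (q ^ size j / q ^ size k) ^ (size N - size k) ≠ 0 := by positivity
  rw [betaWeight_mul_B4 hq ha hc, prod_thetaFac_div hbρ₂ hjk hkN, prod_thetaFac_div hbρ₁ hjk hkN,
    prod_thetaFac_mul_reflect hp hq hx ht hjk hkN, prod_thetaFac_sub_div hq hjk hkN hsize hcx hax]
  unfold subsetTerm
  rw [strip_sdiff_strip hjk]
  simp only [e1, e2, e3, e4]
  have hS : ∏ u ∈ strip j k, (theta p (c / a / q ^ size j * stripVar q x u) * theta p (ρ₁ * stripVar q x u)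
      * (theta p (ρ₂ * stripVar q x u) * theta p (b * q ^ size N * stripVar q x u))) =
      (∏ u ∈ strip j k, theta p (c / a / q ^ size j * stripVar q x u))
        * (∏ u ∈ strip j k, theta p (ρ₁ * stripVar q x u))
        * ((∏ u ∈ strip j k, theta p (ρ₂ * stripVar q x u))
          * ∏ u ∈ strip j k, theta p (b * q ^ size N * stripVar q x u)) := by
    simp only [prod_mul_distrib]
  have hC : ∏ v ∈ strip k N, (theta p (a * q ^ (size j + 1) * stripVar q x v)
      * theta p (b * ρ₂ / a * stripVar q x v) * (theta p (b * ρ₁ / a * stripVar q x v)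
        * theta p (ρ₁ * ρ₂ / a * stripVar q x v / q ^ size N))) =
      (∏ v ∈ strip k N, theta p (a * q ^ (size j + 1) * stripVar q x v))
        * (∏ v ∈ strip k N, theta p (b * ρ₂ / a * stripVar q x v))
        * ((∏ v ∈ strip k N, theta p (b * ρ₁ / a * stripVar q x v))
          * ∏ v ∈ strip k N, theta p (ρ₁ * ρ₂ / a * stripVar q x v / q ^ size N)) := by
    simp only [prod_mul_distrib]
  rw [hS, hC, mul_assoc _ (pairProd _ _ _) (pairProd _ _ _), hsym]
  clear hsym hS hC e1 e2 e3 e4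
  generalize (∏ u ∈ strip j k, ∏ v ∈ strip k N, theta p (stripVar q x u / (q * stripVar q x v))
        / theta p (stripVar q x u / stripVar q x v)) = ratio at hanti ⊢
  generalize ∏ u ∈ strip j N, theta p (c * q * stripVar q x u ^ 2) = Θ at hΘ ⊢
  generalize (q ^ size j / q ^ size k) ^ (size N - size k) = M at hM hanti hmono
  generalize (∏ r, ∏ s, thetaFac p q (q ^ (1 + (j r : ℤ) - j s) * (x r / x s)) ((N r : ℤ) - j r)) = Q₀
    at hQ0 hanti ⊢
  generalize (∏ r, ∏ s, thetaFac p q (q ^ (1 + (k r : ℤ) - k s) * (x r / x s)) ((N r : ℤ) - k r))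
        * ∏ r, ∏ s, thetaFac p q (q ^ (1 + (j r : ℤ) - j s) * (x r / x s)) ((k r : ℤ) - j r) = Q
    at hQ hanti ⊢
  generalize (q / (ρ₁ * ρ₂ / a)) ^ size j * (∏ r, (x r ^ j r)⁻¹) * q ^ pairSum j
    * ∏ u ∈ strip j N, -(q ^ size N / (ρ₁ * ρ₂ / a * stripVar q x u)) = mj at hmono ⊢
  generalize (q / (ρ₁ * ρ₂ / a)) ^ size k * (∏ r, (x r ^ k r)⁻¹) * q ^ pairSum k = mk at hmono ⊢
  generalize ∏ u ∈ strip k N, -(q ^ size N / (ρ₁ * ρ₂ / a * stripVar q x u)) = μk at hmono ⊢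
  generalize (-1 : ℂ) ^ #(strip j k) * (q ^ (#(strip j k)).choose 2)⁻¹ = sgn at hmono ⊢
  have hr : ratio * Q₀⁻¹ = M * Q⁻¹ := by
    field_simp
    linear_combination hanti
  have hΘ' : Θ⁻¹ * Θ = 1 := inv_mul_cancel₀ hΘ
  generalize ∏ u ∈ strip j k, theta p (c / a / q ^ size j * stripVar q x u) = s₁
  generalize ∏ u ∈ strip j k, theta p (ρ₁ * stripVar q x u) = s₂
  generalize ∏ u ∈ strip j k, theta p (ρ₂ * stripVar q x u) = s₃
  generalize ∏ u ∈ strip j k, theta p (b * q ^ size N * stripVar q x u) = s₄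
  generalize ∏ v ∈ strip k N, theta p (a * q ^ (size j + 1) * stripVar q x v) = t₁
  generalize ∏ v ∈ strip k N, theta p (b * ρ₂ / a * stripVar q x v) = t₂
  generalize ∏ v ∈ strip k N, theta p (b * ρ₁ / a * stripVar q x v) = t₃
  generalize ∏ v ∈ strip k N, theta p (ρ₁ * ρ₂ / a * stripVar q x v / q ^ size N) = t₄
  generalize ∏ r, thetaFac p q (ρ₁ * x r) (j r) / thetaFac p q (b * ρ₂ / a * x r) (N r) = f₁
  generalize ∏ r, thetaFac p q (ρ₂ * x r) (j r) / thetaFac p q (b * ρ₁ / a * x r) (N r) = f₂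
  generalize ∏ r, thetaFac p q (b * x r) (size N + j r) = f₃
  generalize (∏ r, thetaFac p q (a * x r * q) (N r + size j))⁻¹ = f₄
  generalize prodLT _ * _ * (prodLT _ / _) * (_ / prodLT _) = σ
  linear_combination (f₁ * f₂ * f₃ * f₄ * s₁ * s₂ * s₃ * s₄ * t₁ * t₂ * t₃ * t₄ * σ) *
    (Q⁻¹ * hmono - sgn * mj * hr - sgn * mj * ratio * Q₀⁻¹ * hΘ')

end Composition

section Composition

variable {n : ℕ} {p q a b c ρ₁ ρ₂ : ℂ} {x : Fin n → ℂ}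

lemma theta_stripVar_div_ne_zero (hp : ‖p‖ < 1) (hq : q ≠ 0) (hx : ∀ r, x r ≠ 0)
    (hqq : ∀ m : ℕ, theta p (q ^ (m + 1)) ≠ 0)
    (hxx : ∀ r s, r ≠ s → ∀ m : ℤ, theta p (q ^ m * (x r / x s)) ≠ 0)
    {u v : Σ _ : Fin n, ℕ} (huv : u ≠ v) : theta p (stripVar q x u / stripVar q x v) ≠ 0 := by
  obtain ⟨r, i⟩ := u
  obtain ⟨s, l⟩ := v
  simp only [stripVar]
  by_cases hrs : r = s
  · subst hrs
    have hr := hx r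
    have hil : i ≠ l := fun h => huv (by rw [h])
    rcases Nat.lt_or_gt_of_ne hil with h | h
    · obtain ⟨m, rfl⟩ := Nat.exists_eq_add_of_lt h
      rw [theta_eq_neg_mul hp (z := x r * q ^ i / (x r * q ^ (i + m + 1))) (w := q ^ (m + 1))
        (by positivity) (by field_simp; ring)]
      exact mul_ne_zero (neg_ne_zero.mpr (by positivity)) (hqq m)
    · obtain ⟨m, rfl⟩ := Nat.exists_eq_add_of_lt h
      convert hqq m using 2
      field_simp
      ring
  · convert hxx r s hrs ((i : ℤ) - l) using 2
    have := hx s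
    rw [zpow_sub₀ hq, zpow_natCast, zpow_natCast]
    field_simp

lemma prod_theta_mul_thetaFac {z w : ℂ} {J M : ℕ} (h : J ≤ M) (hw : w = z * q ^ J) :
    thetaFac p q z J * ∏ i ∈ range (M - J), theta p (w * q ^ i) = thetaFac p q z M := by
  rw [← thetaFac_mul_prod_Ico p q z h, prod_Ico_eq_prod_range]
  congr 1
  refine prod_congr rfl fun i _ => ?_
  rw [hw, pow_add]
  ring_nf

/-- The composition of the two matrices. -/
lemma sum_betaWeight_mul_B4 (hp : ‖p‖ < 1) (hq : q ≠ 0) (ha : a ≠ 0) (hb : b ≠ 0)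
    (hρ₁ : ρ₁ ≠ 0) (hρ₂ : ρ₂ ≠ 0) (hx : ∀ r, x r ≠ 0) (hc : c = b * ρ₁ * ρ₂ / (a * q))
    (hqq : ∀ m : ℕ, theta p (q ^ (m + 1)) ≠ 0)
    (hxx : ∀ r s, r ≠ s → ∀ m : ℤ, theta p (q ^ m * (x r / x s)) ≠ 0)
    (hax : ∀ r, ∀ m : ℕ, theta p (a * x r * q ^ (m + 1)) ≠ 0)
    (haρ₁ : ∀ m : ℕ, theta p (a * q / ρ₁ * q ^ m) ≠ 0)
    (haρ₂ : ∀ m : ℕ, theta p (a * q / ρ₂ * q ^ m) ≠ 0)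
    (hbρ₁ : ∀ r, ∀ m : ℕ, theta p (b * ρ₁ / a * x r * q ^ m) ≠ 0)
    (hbρ₂ : ∀ r, ∀ m : ℕ, theta p (b * ρ₂ / a * x r * q ^ m) ≠ 0)
    (hcxx : ∀ r s, ∀ m : ℕ, theta p (c * x r * x s * q ^ m) ≠ 0) {j N : Fin n → ℕ}
    (hcx : ∀ r i, j r ≤ i → i < size j → theta p (c / a * x r * q ^ ((i : ℤ) - size j)) ≠ 0)
    (hjN : j ≤ N) :
    (∏ r, (thetaFac p q (b * ρ₁ * x r / a) (N r) * thetaFac p q (b * ρ₂ * x r / a) (N r)))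
        / (thetaFac p q (a * q / ρ₁) (size N) * thetaFac p q (a * q / ρ₂) (size N))
      * ∑ k ∈ Icc j N, betaWeight p q ρ₁ ρ₂ x N k a b * B4 p q x k j a c =
    B1 p q x N j a b * alphaWeight p q ρ₁ ρ₂ x j a := by
  have hc0 : c ≠ 0 := by
    rw [hc]
    positivity
  have hy := stripVar_ne_zero hq hx
  have hJN := size_le_size hjN
  have hm : size N = #(strip j N) + size j := by
    rw [card_strip hjN]
    omega
  -- The balancing condition holds because cq = bρ₁ρ₂/a and the strip has |N| - |j| points.
  have hsum := sum_subsetTerm (R := lexLT) (T := strip j N) (A := c * q) (b := c / a / q ^ size j)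
    (c := ρ₁) (d := ρ₂) (e := b * q ^ size N) hp hq (by positivity) hy isOrientation_lexLT
    (fun u _ v _ huv => theta_stripVar_div_ne_zero hp hq hx hqq hxx huv)
    (fun u _ v _ => by
      convert hcxx u.1 v.1 (u.2 + v.2 + 1) using 2
      simp only [stripVar]
      ring)
    (by positivity) hρ₁ hρ₂ (by positivity)
    (by
      rw [hm, pow_add, hc]
      field_simp)
  rw [sum_powerset_strip hjN _ fun S hS r i hi h h' =>
    subsetTerm_eq_zero hp hq hx _ _ _ hS hi h h'] at hsum
  rw [sum_congr rfl fun k hk => betaWeight_mul_B4_eq_subsetTerm hp hq ha hb hρ₁ hρ₂ hx hc hqq hxx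
    hax hbρ₁ hbρ₂ hcxx hcx (mem_Icc.mp hk).1 (mem_Icc.mp hk).2, ← mul_sum, hsum]
  have h1 : thetaFac p q (a * q / ρ₁) (size j)
      * ∏ i ∈ range #(strip j N), theta p (c * q * q ^ i / (c / a / q ^ size j * ρ₁)) =
      thetaFac p q (a * q / ρ₁) (size N) := by
    rw [card_strip hjN, ← prod_theta_mul_thetaFac hJN rfl]
    congr 1
    refine prod_congr rfl fun i _ => ?_
    congr 1
    field_simp
  have h2 : thetaFac p q (a * q / ρ₂) (size j)
      * ∏ i ∈ range #(strip j N), theta p (c * q * q ^ i / (c / a / q ^ size j * ρ₂)) =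
      thetaFac p q (a * q / ρ₂) (size N) := by
    rw [card_strip hjN, ← prod_theta_mul_thetaFac hJN rfl]
    congr 1
    refine prod_congr rfl fun i _ => ?_
    congr 1
    field_simp
  have h3 : ∏ i ∈ range #(strip j N), theta p (c * q * q ^ i / (ρ₁ * ρ₂)) =
      thetaFac p q (b / a) ((size N : ℤ) - size j) := by
    rw [card_strip hjN, ← Nat.cast_sub hJN, thetaFac_natCast]
    refine prod_congr rfl fun i _ => ?_
    congr 1
    rw [hc]
    field_simp
  -- The monomials from the reflected factorials cancel those of the closed form, up to the power of
  -- q by which `subsetSum` divides.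
  have h4 : (∏ u ∈ strip j N, -(q ^ size N / (ρ₁ * ρ₂ / a * stripVar q x u)))
      * ∏ u ∈ strip j N, (-(c / a / q ^ size j * ρ₁ * ρ₂ * stripVar q x u / (c * q))) =
      q ^ (#(strip j N) * (#(strip j N) - 1)) := by
    rw [← prod_mul_distrib, pow_mul', ← prod_const]
    refine prod_congr rfl fun u hu => ?_
    have hyu := hy u
    obtain ⟨m, hm'⟩ := Nat.exists_eq_succ_of_ne_zero (card_ne_zero_of_mem hu)
    rw [hm, hm', Nat.succ_sub_one, pow_add, pow_succ]
    field_simp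
  have n1 := thetaFac_ne_zero haρ₁ (size N)
  have n2 := thetaFac_ne_zero haρ₂ (size N)
  have n3 : ∏ r, thetaFac p q (b * ρ₁ / a * x r) (N r) ≠ 0 :=
    prod_ne_zero_iff.mpr fun r _ => thetaFac_ne_zero (hbρ₁ r) _
  have n4 : ∏ r, thetaFac p q (b * ρ₂ / a * x r) (N r) ≠ 0 :=
    prod_ne_zero_iff.mpr fun r _ => thetaFac_ne_zero (hbρ₂ r) _
  have n5 : ∏ u ∈ strip j N, theta p (c * q * stripVar q x u ^ 2) ≠ 0 := by
    refine prod_ne_zero_iff.mpr fun u _ => ?_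
    convert hcxx u.1 u.1 (2 * u.2 + 1) using 2
    simp only [stripVar]
    ring
  have e1 : ∀ r, b * ρ₁ * x r / a = b * ρ₁ / a * x r := fun r => by ring
  have e2 : ∀ r, b * ρ₂ * x r / a = b * ρ₂ / a * x r := fun r => by ring
  have e3 : a * q / (ρ₁ * ρ₂) = q / (ρ₁ * ρ₂ / a) := by field_simp
  have e4 : ∀ r, (j r : ℤ) + size N = size N + j r := fun r => add_comm _ _
  have hQ : q ^ (#(strip j N) * (#(strip j N) - 1)) ≠ 0 := by positivity
  unfold B1 alphaWeight subsetSum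
  rw [← h1] at n1 ⊢
  rw [← h2] at n2 ⊢
  rw [h3, e3, prod_mul_distrib (f := fun u => theta p (c * q * stripVar q x u ^ 2))]
  simp only [e1, e2, e4]
  rw [prod_mul_distrib, prod_mul_distrib, prod_div_distrib, prod_div_distrib, prod_div_distrib]
  obtain ⟨n1, n1'⟩ := mul_ne_zero_iff.mp n1
  obtain ⟨n2, n2'⟩ := mul_ne_zero_iff.mp n2
  clear hsum h1 h2 h3 e1 e2 e3 e4
  generalize ∏ i ∈ range #(strip j N), theta p (c * q * q ^ i / (c / a / q ^ size j * ρ₁)) = g₁ at n1' ⊢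
  generalize ∏ i ∈ range #(strip j N), theta p (c * q * q ^ i / (c / a / q ^ size j * ρ₂)) = g₂ at n2' ⊢
  generalize q ^ (#(strip j N) * (#(strip j N) - 1)) = Z at hQ h4 ⊢
  generalize (∏ u ∈ strip j N, -(q ^ size N / (ρ₁ * ρ₂ / a * stripVar q x u))) = μ at h4 ⊢
  generalize ∏ u ∈ strip j N, (-(c / a / q ^ size j * ρ₁ * ρ₂ * stripVar q x u / (c * q))) = ν at h4 ⊢
  generalize ∏ u ∈ strip j N, theta p (c * q * stripVar q x u ^ 2) = Θ at n5 ⊢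
  generalize ∏ r, thetaFac p q (b * ρ₁ / a * x r) (N r) = f₁ at n3 ⊢
  generalize ∏ r, thetaFac p q (b * ρ₂ / a * x r) (N r) = f₂ at n4 ⊢
  generalize thetaFac p q (a * q / ρ₁) (size j) = t₁ at n1 ⊢
  generalize thetaFac p q (a * q / ρ₂) (size j) = t₂ at n2 ⊢
  generalize ∏ r, (x r ^ j r)⁻¹ = f₃
  generalize (q / (ρ₁ * ρ₂ / a)) ^ size j = f₄
  generalize ∏ r, thetaFac p q (a * x r * q) (N r + size j) = f₅
  generalize ∏ r, ∏ s, thetaFac p q (q ^ (1 + (j r : ℤ) - j s) * (x r / x s)) ((N r : ℤ) - j r) = f₆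
  generalize ∏ r, thetaFac p q (b * x r) (size N + j r) = f₇
  subst h4
  obtain ⟨m1, m2⟩ := mul_ne_zero_iff.mp hQ
  field_simp

end Composition

end EllipticBailey

/-! ### The WP Bailey lemma -/

open EllipticBailey Finset in
theorem mainTheorem9 (n : ℕ) (p q a b ρ₁ ρ₂ : ℂ) (x : Fin n → ℂ)
    (hp : ‖p‖ < 1) (hq : q ≠ 0) (ha : a ≠ 0) (hb : b ≠ 0) (hρ₁ : ρ₁ ≠ 0) (hρ₂ : ρ₂ ≠ 0)
    (hx : ∀ r, x r ≠ 0)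
    -- no denominator that occurs in the two matrices and in the new pair vanishes
    (hqq : ∀ m : ℕ, EllipticBailey.theta p (q ^ (m + 1)) ≠ 0)
    (hxx : ∀ r s, r ≠ s → ∀ m : ℤ, EllipticBailey.theta p (q ^ m * (x r / x s)) ≠ 0)
    (hax : ∀ r, ∀ m : ℕ, EllipticBailey.theta p (a * x r * q ^ (m + 1)) ≠ 0)
    (haρ₁ : ∀ m : ℕ, EllipticBailey.theta p (a * q ^ (m + 1) / ρ₁) ≠ 0)
    (haρ₂ : ∀ m : ℕ, EllipticBailey.theta p (a * q ^ (m + 1) / ρ₂) ≠ 0)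
    (hbρ₁ : ∀ r, ∀ m : ℕ, EllipticBailey.theta p (b * ρ₁ * x r * q ^ m / a) ≠ 0)
    (hbρ₂ : ∀ r, ∀ m : ℕ, EllipticBailey.theta p (b * ρ₂ * x r * q ^ m / a) ≠ 0)
    (hbxx : ∀ r s, ∀ m : ℕ,
      EllipticBailey.theta p (b * ρ₁ * ρ₂ * x r * x s * q ^ m / (a * q)) ≠ 0)
    (hbx : 2 ≤ n → ∀ r, ∀ m : ℕ,
      EllipticBailey.theta p (b * ρ₁ * ρ₂ * x r / (a ^ 2 * q * q ^ (m + 1))) ≠ 0)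
    (α β : EllipticBailey.Seq n)
    (hαβ : EllipticBailey.IsWPBaileyPair (EllipticBailey.B4 p q x) α β
      a (b * ρ₁ * ρ₂ / (a * q))) :
    EllipticBailey.IsWPBaileyPair (EllipticBailey.B1 p q x)
      (EllipticBailey.alphaPrime p q ρ₁ ρ₂ x α) (EllipticBailey.betaPrime p q ρ₁ ρ₂ x β) a b := by
  set c := b * ρ₁ * ρ₂ / (a * q) with hc
  intro N
  have haρ₁' : ∀ m : ℕ, theta p (a * q / ρ₁ * q ^ m) ≠ 0 := fun m => by
    convert haρ₁ m using 2
    ring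
  have haρ₂' : ∀ m : ℕ, theta p (a * q / ρ₂ * q ^ m) ≠ 0 := fun m => by
    convert haρ₂ m using 2
    ring
  have hbρ₁' : ∀ r, ∀ m : ℕ, theta p (b * ρ₁ / a * x r * q ^ m) ≠ 0 := fun r m => by
    convert hbρ₁ r m using 2
    ring
  have hbρ₂' : ∀ r, ∀ m : ℕ, theta p (b * ρ₂ / a * x r * q ^ m) ≠ 0 := fun r m => by
    convert hbρ₂ r m using 2
    ring
  have hcxx : ∀ r s, ∀ m : ℕ, theta p (c * x r * x s * q ^ m) ≠ 0 := fun r s m => by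
    convert hbxx r s m using 2
    rw [hc]
    ring
  -- Indices with j_r ≤ i < |j| exist only if another coordinate of j is positive, hence only for n
  -- ≥ 2.
  have hcx : ∀ (j : Fin n → ℕ) r i, j r ≤ i → i < size j →
      theta p (c / a * x r * q ^ ((i : ℤ) - size j)) ≠ 0 := by
    intro j r i hji hiJ
    have hn : 2 ≤ n := by
      by_contra! hn
      have : Subsingleton (Fin n) := Fin.subsingleton_iff_le_one.mpr (by omega)
      have : size j = j r := Fintype.sum_subsingleton _ r
      omega
    obtain ⟨m, hm⟩ := Nat.exists_eq_add_of_lt hiJ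
    convert hbx hn r m using 2
    rw [hm, hc, show (i : ℤ) - ((i + m + 1 : ℕ) : ℤ) = -((m + 1 : ℕ) : ℤ) by push_cast; ring,
      zpow_neg, zpow_natCast]
    field_simp
  have hbeta : betaPrime p q ρ₁ ρ₂ x β N a b =
      (∏ r, (thetaFac p q (b * ρ₁ * x r / a) (N r) * thetaFac p q (b * ρ₂ * x r / a) (N r)))
        / (thetaFac p q (a * q / ρ₁) (size N) * thetaFac p q (a * q / ρ₂) (size N))
      * ∑ k ∈ Iic N, betaWeight p q ρ₁ ρ₂ x N k a b * β k a c := rfl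
  have halpha : ∀ j, alphaPrime p q ρ₁ ρ₂ x α j a b = alphaWeight p q ρ₁ ρ₂ x j a * α j a c :=
    fun _ => rfl
  -- B⁽⁴⁾_{kj} enters only for j ≤ k, so interchanging the sums leaves k in the interval from j to
  -- N.
  have hswap : ∑ k ∈ Iic N, betaWeight p q ρ₁ ρ₂ x N k a b * β k a c =
      ∑ j ∈ Iic N, (∑ k ∈ Icc j N, betaWeight p q ρ₁ ρ₂ x N k a b * B4 p q x k j a c) * α j a c := by
    simp only [hαβ _, mul_sum, sum_mul, ← mul_assoc]
    refine sum_comm' fun k j => ?_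
    simp only [mem_Iic, mem_Icc]
    exact ⟨fun h => ⟨⟨h.2, h.1⟩, h.2.trans h.1⟩, fun h => ⟨h.1.2, h.1.1⟩⟩
  rw [hbeta, hswap, mul_sum]
  refine sum_congr rfl fun j hj => ?_
  rw [halpha, ← mul_assoc, ← mul_assoc, sum_betaWeight_mul_B4 hp hq ha hb hρ₁ hρ₂ hx hc hqq hxx hax
    haρ₁' haρ₂' hbρ₁' hbρ₂' hcxx (hcx j) (mem_Iic.mp hj)]
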